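/- **Setting.** Let $N\ge 2$, $\tau>0$, and $$A=\begin{pmatrix}1&\tau\\0&1\end{pmatrix},\quad B=\begin{pmatrix}\tau\\1\end{pmatrix},\quad C=\begin{pmatrix}1&0\end{pmatrix}.$$ An ensemble of $N$ clocks is the system $$x[k+1]=(A\otimes I_N)x[k]+(B\otimes I_N)u[k]+v[k],\qquad y[k]=(C\otimes V)x[k]+w[k],$$ where $V\in\mathbb R^{(N-1)\times N}$ has rank $N-1$ and $V\mathbb 1_N=0$, and $v,w$ are independent white Gaussian processes with covariances $$\mathbf Q=\begin{pmatrix}\tau\Sigma_1+\frac{\tau^3}{3}\Sigma_2&\frac{\tau^2}{2}\Sigma_2\\ \frac{\tau^2}{2}\Sigma_2&\tau\Sigma_2\end{pmatrix},\qquad \mathbf R\succ0,$$ with $\Sigma_1=\mathrm{diag}(\sigma_{1i}^2)$, $\Sigma_2=\mathrm{diag}(\sigma_{2i}^2)$, $\sigma_{1i}\ge 0$, $\sigma_{2i}>0$. Put $\mathbf A_o=A\otimes I_{N-1}$, $\mathbf B_o=B\otimes I_{N-1}$, $\mathbf C_o=C\otimes I_{N-1}$ and $q_\infty=\Sigma_2^{-1}\mathbb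 1_N/(\mathbb 1_N^{\sf T}\Sigma_2^{-1}\mathbb 1_N)$. **Algorithm.** Let $q\in\mathbb R^N$ with $q^{\sf T}\mathbb 1_N=1$, and let $V^+=W(VW)^{-1}$, where $W\in\mathbb R^{N\times(N-1)}$ has full column rank and $q^{\sf T}W=0$. Let $\mathbf H_o^\star,H_{\bar o}^\star$ be the limits of the gains $$\mathbf H_o[k]=\mathbf P_{oo}^-\mathbf C_o^{\sf T}(\mathbf C_o\mathbf P_{oo}^-\mathbf C_o^{\sf T}+\mathbf R)^{-1},\qquad H_{\bar o}[k]=P_{\bar oo}^-\mathbf C_o^{\sf T}(\mathbf C_o\mathbf P_{oo}^-\mathbf C_o^{\sf T}+\mathbf R)^{-1}$$ (with $\mathbf P_{oo}^-=\mathbf P_{oo}^-[k]$, $P_{\bar oo}^-=P_{\bar oo}^-[k]$), where, from any initial values with $\mathbf P_{oo}^-[0]\succeq0$, $$\mathbf P_{oo}^-[k+1]=\mathbf A_o(I-\mathbf H_o[k]\mathbf C_o)\mathbf P_{oo}^-[k]\mathbf A_o^{\sf T}+(I_2\otimes V)\mathbf Q(I_2\otimes V)^{\sf T},$$ $$P_{\bar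 oo}^-[k+1]=\bigl((I_2\otimes q^{\sf T})(A\otimes I_N)(I_2\otimes V^+)(I-\mathbf H_o[k]\mathbf C_o)\mathbf P_{oo}^-[k]+A P_{\bar oo}^-[k](I-\mathbf C_o^{\sf T}\mathbf H_o[k]^{\sf T})\bigr)\mathbf A_o^{\sf T}+(I_2\otimes q^{\sf T})\mathbf Q(I_2\otimes V)^{\sf T}.$$ For gains $\mathbf F_o\in\mathbb R^{(N-1)\times 2(N-1)}$, $K_{\bar o}\in\mathbb R^{1\times2}$ and a period $m\ge1$, apply $u[k]=V^+\omega_o[k]+\mathbb 1_N\omega_{\bar o}[k]$ with $\omega_o[k]=-\mathbf F_o\hat\xi_o[k]$, $\omega_{\bar o}[k]=-F_{\bar o}[k]\hat\xi_{\bar o}[k]$, where $F_{\bar o}[k]=K_{\bar o}$ if $m\mid k$ and $F_{\bar o}[k]=0$ otherwise, and $$\hat\xi_o[k+1]=\mathbf A_o\hat\xi_o[k]+\mathbf B_o\omega_o[k]+\mathbf A_o\mathbf H_o^\star(y[k]-\mathbf C_o\hat\xi_o[k]),$$ $$\hat\xi_{\bar o}[k+1]=A\hat\xi_{\bar o}[k]+B\omega_{\bar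 o}[k]+AH_{\bar o}^\star(y[k]-\mathbf C_o\hat\xi_o[k]).$$ **Synchronization.** Let $\Pi(q_\infty)$ be the free-running dynamics $r[k+1]=Ar[k]+(I_2\otimes q_\infty^{\sf T})v[k]$, driven by the same $v$, and let $\delta[k]=x[k]-(I_2\otimes\mathbb 1_N)r[k]$. The algorithm is said to achieve $\{\delta[k]\}_{k\in m\mathbb Z}\in\mathcal G$ for $\Pi(q_\infty)$ if, for every initial state $(x[0],\hat\xi_o[0],\hat\xi_{\bar o}[0])$, there is an initial state $r[0]$ of $\Pi(q_\infty)$ such that $\{\delta[mk]\}_{k\ge0}$ is, in steady state, a zero-mean stationary Gaussian process: it is a Gaussian process, $\mathbb E\,\delta[mk]\to0$ as $k\to\infty$, and $\mathbb E\,\delta[m(k+i)]\,\delta[m(k+j)]^{\sf T}$ converges to a finite limit as $k\to\infty$ for all $i,j\ge0$. **Theorem.** Suppose that $q\ne q_\infty$. Then the algorithm achieves $\{\delta[k]\}_{k\in m\mathbb Z}\in\mathcal G$ for $\Pi(q_\infty)$ if and only if all eigenvalues of $\mathbf A_o-\mathbf B_o\mathbf F_o$ and all eigenvalues of $A^m-A^{m-1}BK_{\bar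 o}$ lie in the open unit disk. -/

import Mathlib

open MeasureTheory ProbabilityTheory Filter Topology
open scoped Matrix Kronecker

namespace ClockSync

/-- `Λ(M) ⊆ 𝔻`: every complex eigenvalue of the real matrix `M` has modulus less than one. -/
def IsSchur {ι : Type*} [Fintype ι] [DecidableEq ι] (M : Matrix ι ι ℝ) : Prop :=
  ∀ z ∈ spectrum ℂ (M.map (algebraMap ℝ ℂ)), ‖z‖ < 1

/-! ### Single clock and Kronecker products -/

/-- The discrete-time clock matrix `A`. -/
def clockA (τ : ℝ) : Matrix (Fin 2) (Fin 2) ℝ := !![1, τ; 0, 1]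

/-- The input column `B`. -/
def clockB (τ : ℝ) : Fin 2 → ℝ := ![τ, 1]

/-- The output row `C`. -/
def clockC : Fin 2 → ℝ := ![1, 0]

/-- `b ⊗ M` for a column `b` with two entries. -/
def colKron {ι κ : Type*} (b : Fin 2 → ℝ) (M : Matrix ι κ ℝ) : Matrix (Fin 2 × ι) κ ℝ :=
  Matrix.of fun p j => b p.1 * M p.2 j

/-- `c ⊗ M` for a row `c` with two entries. -/
def rowKron {ι κ : Type*} (c : Fin 2 → ℝ) (M : Matrix ι κ ℝ) : Matrix ι (Fin 2 × κ) ℝ :=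
  Matrix.of fun i p => c p.1 * M i p.2

/-- `I₂ ⊗ M` for a matrix `M`. -/
def dupl {ι κ : Type*} (M : Matrix ι κ ℝ) : Matrix (Fin 2 × ι) (Fin 2 × κ) ℝ :=
  (1 : Matrix (Fin 2) (Fin 2) ℝ) ⊗ₖ M

/-- `I₂ ⊗ qᵀ` for a row `qᵀ`. -/
def duplRow {ι : Type*} (q : ι → ℝ) : Matrix (Fin 2) (Fin 2 × ι) ℝ :=
  Matrix.of fun a p => (1 : Matrix (Fin 2) (Fin 2) ℝ) a p.1 * q p.2

/-- `I₂ ⊗ e` for a column `e`. -/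
def duplCol {ι : Type*} (e : ι → ℝ) : Matrix (Fin 2 × ι) (Fin 2) ℝ :=
  Matrix.of fun p a => (1 : Matrix (Fin 2) (Fin 2) ℝ) p.1 a * e p.2

/-- `A ⊗ I`. -/
def bigA {ι : Type*} [DecidableEq ι] (τ : ℝ) : Matrix (Fin 2 × ι) (Fin 2 × ι) ℝ :=
  clockA τ ⊗ₖ (1 : Matrix ι ι ℝ)

/-- `B ⊗ I`. -/
def bigB {ι : Type*} [DecidableEq ι] (τ : ℝ) : Matrix (Fin 2 × ι) ι ℝ :=
  colKron (clockB τ) (1 : Matrix ι ι ℝ)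

/-! ### The ensemble of `N = n + 1` clocks -/

/-- The data of an ensemble of `n + 1` clocks: sampling interval, standard deviations of the white
frequency noise and of the random walk frequency noise of each clock, the matrix `V` selecting
the `n` measured differences of clock readings, and the measurement noise covariance. -/
structure Ensemble (n : ℕ) where
  τ : ℝ
  τ_pos : 0 < τ
  σ₁ : Fin (n + 1) → ℝ
  σ₁_nonneg : ∀ i, 0 ≤ σ₁ i
  σ₂ : Fin (n + 1) → ℝ
  σ₂_pos : ∀ i, 0 < σ₂ i
  V : Matrix (Fin n) (Fin (n + 1)) ℝ
  V_mulVec_one : V *ᵥ 1 = 0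
  V_rank : V.rank = n
  R : Matrix (Fin n) (Fin n) ℝ
  R_posDef : R.PosDef

/-- Index set of the ensemble state: (phase or frequency, clock). -/
abbrev Idx (n : ℕ) : Type := Fin 2 × Fin (n + 1)

/-- Index set of the relative (observable) state. -/
abbrev ObsIdx (n : ℕ) : Type := Fin 2 × Fin n

variable {n : ℕ}

/-- State of the controlled ensemble: the clock states `x` and the prior estimates of the
observable state and of the unobservable state (the ensemble mean). -/
structure LoopState (n : ℕ) where
  x : Idx n → ℝ
  ξo : ObsIdx n → ℝ
  ξb : Fin 2 → ℝ

/-- The parameters of the synchronization algorithm: the feedback gain `F_o`, the gain `K_ō` of the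
intermittent collective feedback and its period `m`. -/
structure Controller (n : ℕ) where
  Fo : Matrix (Fin n) (ObsIdx n) ℝ
  K : Fin 2 → ℝ
  m : ℕ

/-- The intermittent gain `F_ō[k]`: it is `K_ō` at the multiples of `m`, and zero otherwise. -/
def Controller.Fb (c : Controller n) (k : ℕ) : Fin 2 → ℝ :=
  if c.m ∣ k then c.K else 0

namespace Ensemble

/-- Process noise covariance `𝐐`. -/
noncomputable def Q (E : Ensemble n) : Matrix (Idx n) (Idx n) ℝ :=
  !![E.τ, 0; 0, 0] ⊗ₖ Matrix.diagonal (fun i => E.σ₁ i ^ 2)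
    + !![E.τ ^ 3 / 3, E.τ ^ 2 / 2; E.τ ^ 2 / 2, E.τ] ⊗ₖ Matrix.diagonal (fun i => E.σ₂ i ^ 2)

/-- `𝐀 = A ⊗ I_N`. -/
def AN (E : Ensemble n) : Matrix (Idx n) (Idx n) ℝ := bigA E.τ

/-- `𝐁 = B ⊗ I_N`. -/
def BN (E : Ensemble n) : Matrix (Idx n) (Fin (n + 1)) ℝ := bigB E.τ

/-- `𝐂 = C ⊗ V`. -/
def CN (E : Ensemble n) : Matrix (Fin n) (Idx n) ℝ := rowKron clockC E.V

/-- `A ⊗ I_{N-1}`. -/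
def Ao (E : Ensemble n) : Matrix (ObsIdx n) (ObsIdx n) ℝ := bigA E.τ

/-- `B ⊗ I_{N-1}`. -/
def Bo (E : Ensemble n) : Matrix (ObsIdx n) (Fin n) ℝ := bigB E.τ

/-- `C ⊗ I_{N-1}`. -/
def Co (_E : Ensemble n) : Matrix (Fin n) (ObsIdx n) ℝ := rowKron clockC 1

/-- `q_∞ = Σ₂⁻¹ 𝟙 / (𝟙ᵀ Σ₂⁻¹ 𝟙)`, where `Σ₂` is diagonal with entries `σ₂ᵢ²`. -/
noncomputable def qInf (E : Ensemble n) : Fin (n + 1) → ℝ :=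
  fun i => (E.σ₂ i ^ 2)⁻¹ / ∑ j, (E.σ₂ j ^ 2)⁻¹

/-- The generalized inverse `V⁺ = W (V W)⁻¹`. -/
noncomputable def Vplus (E : Ensemble n) (W : Matrix (Fin (n + 1)) (Fin n) ℝ) :
    Matrix (Fin (n + 1)) (Fin n) ℝ :=
  W * (E.V * W)⁻¹

/-! ### Determinate Kalman filter, in the basis with `𝐔 = I₂ ⊗ V⁺` and `𝐔̄ = I₂ ⊗ qᵀ` -/

/-- The Kalman gains `(H_o, H_ō)` computed from the prior covariances `(P_oo⁻, P_ōo⁻)`. -/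
noncomputable def gain (E : Ensemble n)
    (P : Matrix (ObsIdx n) (ObsIdx n) ℝ × Matrix (Fin 2) (ObsIdx n) ℝ) :
    Matrix (ObsIdx n) (Fin n) ℝ × Matrix (Fin 2) (Fin n) ℝ :=
  (P.1 * E.Coᵀ * (E.Co * P.1 * E.Coᵀ + E.R)⁻¹, P.2 * E.Coᵀ * (E.Co * P.1 * E.Coᵀ + E.R)⁻¹)

/-- The posterior covariances `(P_oo, P_ōo)` computed from the prior ones. -/
noncomputable def posterior (E : Ensemble n)
    (P : Matrix (ObsIdx n) (ObsIdx n) ℝ × Matrix (Fin 2) (ObsIdx n) ℝ) :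
    Matrix (ObsIdx n) (ObsIdx n) ℝ × Matrix (Fin 2) (ObsIdx n) ℝ :=
  ((1 - (E.gain P).1 * E.Co) * P.1, P.2 * (1 - E.Coᵀ * (E.gain P).1ᵀ))

/-- The prior covariances at the next time, computed from the posterior ones. -/
noncomputable def predict (E : Ensemble n) (q : Fin (n + 1) → ℝ)
    (W : Matrix (Fin (n + 1)) (Fin n) ℝ)
    (P : Matrix (ObsIdx n) (ObsIdx n) ℝ × Matrix (Fin 2) (ObsIdx n) ℝ) :
    Matrix (ObsIdx n) (ObsIdx n) ℝ × Matrix (Fin 2) (ObsIdx n) ℝ :=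
  (E.Ao * P.1 * E.Aoᵀ + dupl E.V * E.Q * (dupl E.V)ᵀ,
   (duplRow q * E.AN * dupl (E.Vplus W) * P.1 + clockA E.τ * P.2) * E.Aoᵀ
     + duplRow q * E.Q * (dupl E.V)ᵀ)

/-- The prior covariances `(P_oo⁻[k], P_ōo⁻[k])` started from `P₀` at time `0`. -/
noncomputable def prior (E : Ensemble n) (q : Fin (n + 1) → ℝ)
    (W : Matrix (Fin (n + 1)) (Fin n) ℝ)
    (P₀ : Matrix (ObsIdx n) (ObsIdx n) ℝ × Matrix (Fin 2) (ObsIdx n) ℝ) :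
    ℕ → Matrix (ObsIdx n) (ObsIdx n) ℝ × Matrix (Fin 2) (ObsIdx n) ℝ
  | 0 => P₀
  | k + 1 => E.predict q W (E.posterior (E.prior q W P₀ k))

/-- The stationary Kalman gains `(H_o⋆, H_ō⋆)`: the limits of the Kalman gains. -/
noncomputable def stationaryGain (E : Ensemble n) (q : Fin (n + 1) → ℝ)
    (W : Matrix (Fin (n + 1)) (Fin n) ℝ)
    (P₀ : Matrix (ObsIdx n) (ObsIdx n) ℝ × Matrix (Fin 2) (ObsIdx n) ℝ) :
    Matrix (ObsIdx n) (Fin n) ℝ × Matrix (Fin 2) (Fin n) ℝ :=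
  limUnder atTop fun k => E.gain (E.prior q W P₀ k)

/-! ### The closed loop -/

/-- One step at time `k`, with noises `v = v[k]` and `w = w[k]` and Kalman gains `H`. -/
noncomputable def step (E : Ensemble n) (W : Matrix (Fin (n + 1)) (Fin n) ℝ)
    (H : Matrix (ObsIdx n) (Fin n) ℝ × Matrix (Fin 2) (Fin n) ℝ) (c : Controller n)
    (k : ℕ) (v : Idx n → ℝ) (w : Fin n → ℝ) (s : LoopState n) : LoopState n :=
  let y : Fin n → ℝ := E.CN *ᵥ s.x + w
  let ωo : Fin n → ℝ := -(c.Fo *ᵥ s.ξo)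
  let ωb : ℝ := -(c.Fb k ⬝ᵥ s.ξb)
  let u : Fin (n + 1) → ℝ := E.Vplus W *ᵥ ωo + ωb • (1 : Fin (n + 1) → ℝ)
  { x := E.AN *ᵥ s.x + E.BN *ᵥ u + v
    ξo := E.Ao *ᵥ s.ξo + E.Bo *ᵥ ωo + (E.Ao * H.1) *ᵥ (y - E.Co *ᵥ s.ξo)
    ξb := clockA E.τ *ᵥ s.ξb + ωb • clockB E.τ + (clockA E.τ * H.2) *ᵥ (y - E.Co *ᵥ s.ξo) }

/-- The trajectory of the closed loop from the state `s₀` at time `0`, for noise sequences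
`v` and `w`. -/
noncomputable def loop (E : Ensemble n) (W : Matrix (Fin (n + 1)) (Fin n) ℝ)
    (H : Matrix (ObsIdx n) (Fin n) ℝ × Matrix (Fin 2) (Fin n) ℝ) (c : Controller n)
    (v : ℕ → Idx n → ℝ) (w : ℕ → Fin n → ℝ) (s₀ : LoopState n) : ℕ → LoopState n
  | 0 => s₀
  | k + 1 => E.step W H c k (v k) (w k) (E.loop W H c v w s₀ k)

/-- The state `r` of the free-running ensemble mean dynamics `Π(q)`, from `r₀` at time `0`. -/
noncomputable def freeMean (E : Ensemble n) (q : Fin (n + 1) → ℝ) (v : ℕ → Idx n → ℝ)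
    (r₀ : Fin 2 → ℝ) : ℕ → Fin 2 → ℝ
  | 0 => r₀
  | k + 1 => clockA E.τ *ᵥ E.freeMean q v r₀ k + duplRow q *ᵥ v k

end Ensemble

/-! ### Gaussian processes -/

/-- White Gaussian process with covariance `S`. -/
structure IsWhiteGaussian {Ω ι : Type*} [MeasurableSpace Ω] [Fintype ι]
    (v : ℕ → Ω → ι → ℝ) (S : Matrix ι ι ℝ) (P : Measure Ω) : Prop where
  gaussian : IsGaussianProcess v P
  mean : ∀ k a, ∫ ω, v k ω a ∂P = 0
  cov : ∀ k l a b, ∫ ω, v k ω a * v l ω b ∂P = if k = l then S a b else 0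

/-- In steady state, `X` is a zero-mean stationary Gaussian process: `X` is a Gaussian process and,
as `k → ∞`, its mean tends to zero and `𝔼[X[k+i] X[k+j]ᵀ]` tends to a finite limit `r i j`
for all lags `i`, `j`. -/
structure IsSteadyStationary {Ω ι : Type*} [MeasurableSpace Ω] [Fintype ι]
    (X : ℕ → Ω → ι → ℝ) (P : Measure Ω) : Prop where
  gaussian : IsGaussianProcess X P
  mean : ∀ a, Tendsto (fun k => ∫ ω, X k ω a ∂P) atTop (𝓝 0)
  cov : ∃ r : ℕ → ℕ → Matrix ι ι ℝ, ∀ i j a b,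
    Tendsto (fun k => ∫ ω, X (k + i) ω a * X (k + j) ω b ∂P) atTop (𝓝 (r i j a b))

namespace Ensemble

/-- The synchronization error `δ[k] = x[k] - (I₂ ⊗ 𝟙) r[k]` relative to `Π(q')`, when the closed
loop starts from `s₀` and `Π(q')` from `r₀`. -/
noncomputable def syncError {Ω : Type*} (E : Ensemble n) (W : Matrix (Fin (n + 1)) (Fin n) ℝ)
    (H : Matrix (ObsIdx n) (Fin n) ℝ × Matrix (Fin 2) (Fin n) ℝ) (c : Controller n)
    (q' : Fin (n + 1) → ℝ) (v : ℕ → Ω → Idx n → ℝ) (w : ℕ → Ω → Fin n → ℝ)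
    (s₀ : LoopState n) (r₀ : Fin 2 → ℝ) (k : ℕ) (ω : Ω) : Idx n → ℝ :=
  (E.loop W H c (fun l => v l ω) (fun l => w l ω) s₀ k).x
    - duplCol 1 *ᵥ E.freeMean q' (fun l => v l ω) r₀ k

/-- The algorithm achieves `{δ[k]}_{k ∈ mℤ} ∈ 𝒢` for `Π(q')`: whatever the initial state of the
closed loop, the error relative to some trajectory of `Π(q')`, sampled at the
multiples of `m`, is zero-mean stationary Gaussian in steady state. -/
def AchievesSync {Ω : Type*} [MeasurableSpace Ω] (P : Measure Ω) (E : Ensemble n)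
    (W : Matrix (Fin (n + 1)) (Fin n) ℝ)
    (H : Matrix (ObsIdx n) (Fin n) ℝ × Matrix (Fin 2) (Fin n) ℝ) (c : Controller n)
    (q' : Fin (n + 1) → ℝ) (v : ℕ → Ω → Idx n → ℝ) (w : ℕ → Ω → Fin n → ℝ) : Prop :=
  ∀ s₀ : LoopState n, ∃ r₀ : Fin 2 → ℝ,
    IsSteadyStationary (fun k => E.syncError W H c q' v w s₀ r₀ (c.m * k)) P

end Ensemble

end ClockSync

namespace ClockSync

/-! ### Schur matrices and powers -/

section Schur

/-! The noise of the mean weighted by q_∞ is almost uncorrelated with the noise of the clock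
differences: q_∞ᵀΣ₂ is proportional to 𝟙ᵀ, and V𝟙 = 0. What remains comes from Σ₁ and contributes to
the stationary cross covariance only a constant matrix annihilated by the output (`crossBias_eq`,
`crossBias_mul_Co`). Writing qᵀ = tᵀV + q_∞ᵀ, the limiting gains therefore satisfy H_ō⋆ = (I₂ ⊗
tᵀ)H_o⋆ (`exists_stationaryGain_eq`). Their existence rests on convergence of the Riccati recursion
(`riccati_tendsto`).

Let e be the observable estimation error. By the gain identity, (I₂ ⊗ qᵀ)x - r - ξ̂_ō - (I₂ ⊗ tᵀ)e
moves freely under A, without noise or control (`step_meanErr`). Hence δ is a linear function of (e,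
ξ̂_o, ξ̂_ō) plus 𝟙 ⊗ A^k p, where p can be set through r[0] (`syncError_eq`). Choosing p = 0 gives
sufficiency: what is left is the output of a stable, block triangular, m-periodic system driven by
white noise.

For necessity, the means starting from e = 0 give stability of A_o - B_o F_o at once. For Φ = A^m -
A^{m-1}BK they give less: for each η some p makes Φ^k η + A^{mk} p tend to 0, so the free motion may
hide an instability. It can hide only an eigenvalue 1 with eigenvector (1, 0), and then K₀ = 0 and
K₁ ≥ 0 (`gain_of_compensated`). This case is excluded by variances. A left fixed vector of the joint
period matrix of (e, ξ̂_ō) would accumulate variance linearly, whereas its variance is bounded by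
those of e and δ; so it must annihilate the noise of a whole period, which yields a with (a ⊗
t)ᵀH_o⋆ = 0, a₀a₁ ≥ 0 and a₁ ≠ 0. `vecMul_gain_ne_zero` shows that this is impossible when q ≠ q_∞.
-/

lemma mulVec_re_im {ι κ : Type*} [Fintype ι] (M : Matrix κ ι ℝ) (x : ι → ℂ) (i : κ) :
    (M.map (algebraMap ℝ ℂ) *ᵥ x) i =
      ((M *ᵥ fun j => (x j).re) i : ℂ) + ((M *ᵥ fun j => (x j).im) i : ℂ) * Complex.I := by
  simp only [Matrix.mulVec, dotProduct, Matrix.map_apply, Complex.ofReal_sum, Complex.ofReal_mul,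
    Finset.sum_mul, ← Finset.sum_add_distrib, Complex.coe_algebraMap]
  refine Finset.sum_congr rfl fun j _ => ?_
  conv_lhs => rw [← Complex.re_add_im (x j)]
  ring

variable {ι κ : Type*} [Fintype ι] [DecidableEq ι] [Fintype κ] [DecidableEq κ]

lemma isSchur_iff_eigenvector {M : Matrix ι ι ℝ} :
    IsSchur M ↔ ∀ (z : ℂ) (x : ι → ℂ), x ≠ 0 → M.map (algebraMap ℝ ℂ) *ᵥ x = z • x → ‖z‖ < 1 := by
  unfold IsSchur
  rw [← Matrix.spectrum_toLin']
  constructor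
  · intro h z x hx hz
    refine h z (Module.End.HasEigenvalue.mem_spectrum ?_)
    exact Module.End.hasEigenvalue_of_hasEigenvector (x := x)
      ⟨Module.End.mem_eigenspace_iff.2 (by simpa using hz), hx⟩
  · intro h z hz
    obtain ⟨x, hx⟩ := (Module.End.hasEigenvalue_iff_mem_spectrum.2 hz).exists_hasEigenvector
    exact h z x hx.2 (by simpa using hx.apply_eq_smul)

lemma map_pow_mulVec_eigenvector {M : Matrix ι ι ℂ} {z : ℂ} {x : ι → ℂ} (h : M *ᵥ x = z • x)
    (k : ℕ) : M ^ k *ᵥ x = z ^ k • x := by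
  induction k with
  | zero => simp
  | succ k ih => rw [pow_succ', ← Matrix.mulVec_mulVec, ih, Matrix.mulVec_smul, h, smul_smul,
      ← pow_succ]

/-- Real convergence applied to the real and imaginary parts of an eigenvector gives (z^m)^k → 0.
Sampling at multiples of m loses nothing, since ‖z‖^m < 1 forces ‖z‖ < 1. -/
lemma isSchur_of_tendsto_mulVec {M : Matrix ι ι ℝ} {m : ℕ} (hm : m ≠ 0)
    (h : ∀ x : ι → ℝ, Tendsto (fun k => M ^ (m * k) *ᵥ x) atTop (𝓝 0)) : IsSchur M := by
  rw [isSchur_iff_eigenvector]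
  intro z x hx hz
  obtain ⟨i, hi⟩ := Function.ne_iff.1 hx
  have h1 : Tendsto (fun k => z ^ (m * k) * x i) atTop (𝓝 0) := by
    have h2 : ∀ k, z ^ (m * k) * x i =
        (((M ^ (m * k)) *ᵥ fun j => (x j).re) i : ℂ) +
          (((M ^ (m * k)) *ᵥ fun j => (x j).im) i : ℂ) * Complex.I := by
      intro k
      rw [← mulVec_re_im, Matrix.map_pow, map_pow_mulVec_eigenvector hz, Pi.smul_apply, smul_eq_mul]
    simp_rw [h2]
    have h3 (y : ι → ℝ) : Tendsto (fun k => (((M ^ (m * k)) *ᵥ y) i : ℂ)) atTop (𝓝 0) := by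
      have := (tendsto_pi_nhds.1 (h y)) i
      exact_mod_cast (Complex.continuous_ofReal.tendsto _).comp this
    simpa using (h3 _).add ((h3 _).mul_const Complex.I)
  have h4 : Tendsto (fun k => (z ^ m) ^ k) atTop (𝓝 0) := by
    have := h1.mul_const (x i)⁻¹
    simpa [mul_assoc, mul_inv_cancel₀ (show x i ≠ 0 from hi), pow_mul] using this
  have h5 := tendsto_pow_atTop_nhds_zero_iff_norm_lt_one.1 h4
  rw [norm_pow] at h5
  exact (pow_lt_one_iff_of_nonneg (norm_nonneg z) hm).1 h5

lemma isSchur_of_tendsto_pow {M : Matrix ι ι ℝ} (h : Tendsto (fun k => M ^ k) atTop (𝓝 0)) :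
    IsSchur M := by
  refine isSchur_of_tendsto_mulVec one_ne_zero fun x => ?_
  have h2 : Continuous fun N : Matrix ι ι ℝ => N *ᵥ x := by fun_prop
  simpa [Function.comp_def] using (h2.tendsto 0).comp h

/-- Gelfand's formula for the complexified matrix: the powers are eventually bounded by r^k for some
r < 1 above the spectral radius, in a norm that dominates every entry. -/
lemma IsSchur.tendsto_pow {M : Matrix ι ι ℝ} (h : IsSchur M) :
    Tendsto (fun k => M ^ k) atTop (𝓝 0) := by
  cases isEmpty_or_nonempty ι
  · exact tendsto_pi_nhds.2 fun i => isEmptyElim i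
  let _ : NormedRing (Matrix ι ι ℂ) := Matrix.linftyOpNormedRing
  let _ : NormedAlgebra ℂ (Matrix ι ι ℂ) := Matrix.linftyOpNormedAlgebra
  have : CompleteSpace (Matrix ι ι ℂ) := FiniteDimensional.complete ℂ _
  set a : Matrix ι ι ℂ := M.map (algebraMap ℝ ℂ)
  have h1 : spectralRadius ℂ a < 1 := by
    have := spectrum.spectralRadius_lt_of_forall_lt a (r := 1) fun z hz => h z hz
    simpa using this
  obtain ⟨r, hr1, hr2⟩ := ENNReal.lt_iff_exists_nnreal_btwn.1 h1
  have hr3 : (r : ℝ) < 1 := by exact_mod_cast hr2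
  have h2 : Tendsto (fun k => ‖a ^ k‖) atTop (𝓝 0) := by
    refine squeeze_zero' (.of_forall fun _ => norm_nonneg _) ?_
      (tendsto_pow_atTop_nhds_zero_of_lt_one r.2 hr3)
    have hlim := spectrum.pow_nnnorm_pow_one_div_tendsto_nhds_spectralRadius a
    filter_upwards [hlim.eventually_lt_const hr1, eventually_gt_atTop 0] with k hk hk0
    have hk' : (k : ℝ) ≠ 0 := by positivity
    have h3 : (‖a ^ k‖₊ : ENNReal) ≤ (r : ENNReal) ^ k := by
      have h4 := ENNReal.rpow_le_rpow hk.le (Nat.cast_nonneg (α := ℝ) k)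
      rwa [← ENNReal.rpow_mul, one_div, inv_mul_cancel₀ hk', ENNReal.rpow_one,
        ENNReal.rpow_natCast] at h4
    exact_mod_cast h3
  refine tendsto_pi_nhds.2 fun i => tendsto_pi_nhds.2 fun j => ?_
  refine squeeze_zero_norm (fun k => ?_) h2
  have h5 : ‖(M ^ k) i j‖ = ‖(a ^ k) i j‖ := by
    have h7 : a ^ k = (M ^ k).map (algebraMap ℝ ℂ) := (Matrix.map_pow _ _ _).symm
    simp [h7]
  rw [h5, Matrix.linfty_opNorm_def]
  have h6 : ‖(a ^ k) i j‖₊ ≤ Finset.univ.sup fun i => ∑ j, ‖(a ^ k) i j‖₊ :=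
    (Finset.single_le_sum (f := fun j => ‖(a ^ k) i j‖₊) (fun _ _ => zero_le)
      (Finset.mem_univ j)).trans
      (Finset.le_sup (f := fun i => ∑ j, ‖(a ^ k) i j‖₊) (Finset.mem_univ i))
  exact_mod_cast h6

lemma isSchur_fromBlocks {M₁ : Matrix ι ι ℝ} {M₂ : Matrix κ κ ℝ} (h₁ : IsSchur M₁)
    (h₂ : IsSchur M₂) (X : Matrix κ ι ℝ) : IsSchur (Matrix.fromBlocks M₁ 0 X M₂) := by
  rw [isSchur_iff_eigenvector] at *
  intro z x hx hz
  rw [Matrix.fromBlocks_map, ← Sum.elim_comp_inl_inr x, Matrix.fromBlocks_mulVec] at hz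
  have hz1 : M₁.map (algebraMap ℝ ℂ) *ᵥ (x ∘ Sum.inl) = z • (x ∘ Sum.inl) := by
    ext i
    simpa using congrFun hz (Sum.inl i)
  by_cases h0 : x ∘ Sum.inl = 0
  · refine h₂ z (x ∘ Sum.inr) (fun h0' => hx ?_) ?_
    · rw [← Sum.elim_comp_inl_inr x, h0, h0']
      ext (i | i) <;> rfl
    · ext i
      simpa [h0] using congrFun hz (Sum.inr i)
  · exact h₁ z _ h0 hz1

/-- The iterates of `X ↦ Φ X Φᵀ + N` converge if `Φ` is stable. -/
lemma exists_tendsto_of_affine_recursion {Φ N : Matrix ι ι ℝ} {X : ℕ → Matrix ι ι ℝ}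
    (hΦ : Tendsto (fun k => Φ ^ k) atTop (𝓝 0)) (hX : ∀ k, X (k + 1) = Φ * X k * Φᵀ + N) :
    ∃ Y, Tendsto X atTop (𝓝 Y) := by
  have hconj (Z : Matrix ι ι ℝ) : Tendsto (fun k => Φ ^ k * Z * (Φ ^ k)ᵀ) atTop (𝓝 0) := by
    have hc : Continuous fun M : Matrix ι ι ℝ => M * Z * Mᵀ := by fun_prop
    simpa only [Function.comp_def, zero_mul] using (hc.tendsto 0).comp hΦ
  let L : Matrix ι ι ℝ →ₗ[ℝ] Matrix ι ι ℝ :=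
    { toFun := fun Z => Z - Φ * Z * Φᵀ
      map_add' := fun a b => by simp only [mul_add, add_mul]; abel
      map_smul' := fun c a => by simp [smul_sub] }
  -- A fixed point of Z ↦ Φ Z Φᵀ equals all its iterates, which tend to zero. In finite dimension,
  -- injectivity of `L` then provides the stationary solution.
  have hinj : Function.Injective L := by
    refine (injective_iff_map_eq_zero L).2 fun Z hZ => ?_
    have h1 : Φ * Z * Φᵀ = Z := (sub_eq_zero.1 hZ).symm
    have h2 : ∀ k, Φ ^ k * Z * (Φ ^ k)ᵀ = Z := by
      intro k
      induction k with
      | zero => simp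
      | succ k ih =>
        rw [pow_succ, Matrix.transpose_mul]
        calc _ = Φ ^ k * (Φ * Z * Φᵀ) * (Φ ^ k)ᵀ := by simp only [mul_assoc]
          _ = Z := by rw [h1, ih]
    exact tendsto_nhds_unique (by simp_rw [h2]; exact tendsto_const_nhds) (hconj Z)
  obtain ⟨Y, hY⟩ := LinearMap.surjective_of_injective hinj N
  have hY' : Y = Φ * Y * Φᵀ + N := by rw [← hY]; simp [L]
  refine ⟨Y, ?_⟩
  have h3 : ∀ k, X k = Y + Φ ^ k * (X 0 - Y) * (Φ ^ k)ᵀ := by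
    intro k
    induction k with
    | zero => simp
    | succ k ih =>
      rw [hX, ih, pow_succ', Matrix.transpose_mul]
      nth_rw 3 [hY']
      simp only [mul_add, add_mul, mul_assoc]
      abel
  have := (hconj (X 0 - Y)).const_add Y
  simp_rw [← h3, add_zero] at this
  exact this

end Schur

/-! ### Quadratic forms -/

section QuadraticForms

lemma posSemidef_conj {ι κ : Type*} [Fintype ι] [Fintype κ] {M : Matrix ι ι ℝ}
    (h : M.PosSemidef) (B : Matrix κ ι ℝ) : (B * M * Bᵀ).PosSemidef := by
  simpa using h.mul_mul_conjTranspose_same B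

lemma posSemidef_symm {ι : Type*} {M : Matrix ι ι ℝ} (h : M.PosSemidef) : Mᵀ = M := by
  simpa using h.1.eq

lemma tendsto_zero_of_geometric {ι : Type*} {M : ℕ → Matrix ι ι ℝ} {b r : ℝ} (hr0 : 0 ≤ r)
    (hr1 : r < 1)
    (h : ∀ k i j, |M k i j| ≤ b * r ^ k) : Tendsto M atTop (𝓝 0) := by
  refine tendsto_pi_nhds.2 fun i => tendsto_pi_nhds.2 fun j => ?_
  refine squeeze_zero_norm (fun k => h k i j) ?_
  simpa using (tendsto_pow_atTop_nhds_zero_of_lt_one hr0 hr1).const_mul b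

variable {ι : Type*} [Fintype ι]

lemma posSemidef_quad_nonneg {M : Matrix ι ι ℝ} (h : M.PosSemidef) (x : ι → ℝ) :
    0 ≤ x ⬝ᵥ M *ᵥ x := by
  simpa using h.dotProduct_mulVec_nonneg x

lemma posDef_quad_pos {M : Matrix ι ι ℝ} (h : M.PosDef) {x : ι → ℝ} (hx : x ≠ 0) :
    0 < x ⬝ᵥ M *ᵥ x := by
  simpa using h.dotProduct_mulVec_pos hx

lemma quad_le_of_posSemidef_sub {M N : Matrix ι ι ℝ} (h : (N - M).PosSemidef) (x : ι → ℝ) :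
    x ⬝ᵥ M *ᵥ x ≤ x ⬝ᵥ N *ᵥ x := by
  have := posSemidef_quad_nonneg h x
  rw [Matrix.sub_mulVec, dotProduct_sub] at this
  linarith

lemma quad_conj {κ : Type*} [Fintype κ] (M : Matrix ι ι ℝ) (B : Matrix κ ι ℝ) (x : κ → ℝ) :
    x ⬝ᵥ (B * M * Bᵀ) *ᵥ x = (Bᵀ *ᵥ x) ⬝ᵥ M *ᵥ (Bᵀ *ᵥ x) := by
  rw [← Matrix.mulVec_mulVec, ← Matrix.mulVec_mulVec, Matrix.dotProduct_mulVec,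
    Matrix.mulVec_transpose]

lemma polarization [DecidableEq ι] {M : Matrix ι ι ℝ} (h : Mᵀ = M) (i j : ι) :
    M i j = ((Pi.single i 1 + Pi.single j 1) ⬝ᵥ M *ᵥ (Pi.single i 1 + Pi.single j 1)
      - Pi.single i 1 ⬝ᵥ M *ᵥ Pi.single i 1 - Pi.single j 1 ⬝ᵥ M *ᵥ Pi.single j 1) / 2 := by
  have h1 : M j i = M i j := congrFun (congrFun h i) j
  simp only [Matrix.mulVec_add, Matrix.mulVec_single_one, dotProduct_add, add_dotProduct,
    single_one_dotProduct, Matrix.col_apply, h1]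
  ring

/-- By polarization the entries are combinations of values of the quadratic form. This lets monotone
convergence of real sequences serve for matrices. -/
lemma exists_tendsto_of_quad [DecidableEq ι] {M : ℕ → Matrix ι ι ℝ} (hM : ∀ k, (M k)ᵀ = M k)
    (h : ∀ x : ι → ℝ, ∃ l, Tendsto (fun k => x ⬝ᵥ M k *ᵥ x) atTop (𝓝 l)) :
    ∃ N, Tendsto M atTop (𝓝 N) := by
  choose l hl using h
  refine ⟨fun i j =>
    (l (Pi.single i 1 + Pi.single j 1) - l (Pi.single i 1) - l (Pi.single j 1)) / 2,
    tendsto_pi_nhds.2 fun i => tendsto_pi_nhds.2 fun j => ?_⟩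
  simp_rw [fun k => polarization (hM k) i j]
  exact (((hl _).sub (hl _)).sub (hl _)).div_const 2

lemma tendsto_of_quad [DecidableEq ι] {M : ℕ → Matrix ι ι ℝ} {N : Matrix ι ι ℝ}
    (hM : ∀ k, (M k)ᵀ = M k) (hN : Nᵀ = N)
    (h : ∀ x : ι → ℝ, Tendsto (fun k => x ⬝ᵥ M k *ᵥ x) atTop (𝓝 (x ⬝ᵥ N *ᵥ x))) :
    Tendsto M atTop (𝓝 N) := by
  refine tendsto_pi_nhds.2 fun i => tendsto_pi_nhds.2 fun j => ?_
  simp_rw [fun k => polarization (hM k) i j, polarization hN i j]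
  exact (((h _).sub (h _)).sub (h _)).div_const 2

lemma tendsto_quad {M : ℕ → Matrix ι ι ℝ} {N : Matrix ι ι ℝ} (h : Tendsto M atTop (𝓝 N))
    (x : ι → ℝ) : Tendsto (fun k => x ⬝ᵥ M k *ᵥ x) atTop (𝓝 (x ⬝ᵥ N *ᵥ x)) := by
  have hc : Continuous fun M : Matrix ι ι ℝ => x ⬝ᵥ M *ᵥ x := by fun_prop
  exact (hc.tendsto N).comp h

lemma posSemidef_of_tendsto {M : ℕ → Matrix ι ι ℝ} {N : Matrix ι ι ℝ}
    (h : Tendsto M atTop (𝓝 N)) (hM : ∀ k, (M k).PosSemidef) : N.PosSemidef := by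
  refine .of_dotProduct_mulVec_nonneg ?_ fun x => ?_
  · have hc : Continuous fun M : Matrix ι ι ℝ => Mᵀ := by fun_prop
    have h1 := (hc.tendsto N).comp h
    simp only [Function.comp_def, fun k => posSemidef_symm (hM k)] at h1
    rw [Matrix.IsHermitian, Matrix.conjTranspose_eq_transpose_of_trivial]
    exact tendsto_nhds_unique h1 h
  · simpa using ge_of_tendsto' (tendsto_quad h x) fun k => posSemidef_quad_nonneg (hM k) x

lemma quad_le_sum_abs_mul (M : Matrix ι ι ℝ) (x : ι → ℝ) :
    x ⬝ᵥ M *ᵥ x ≤ (∑ i, ∑ j, |M i j|) * ‖x‖ ^ 2 := by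
  simp only [dotProduct, Matrix.mulVec, Finset.mul_sum, Finset.sum_mul]
  refine Finset.sum_le_sum fun i _ => Finset.sum_le_sum fun j _ => ?_
  calc x i * (M i j * x j) ≤ |x i * (M i j * x j)| := le_abs_self _
    _ = |M i j| * (|x i| * |x j|) := by rw [abs_mul, abs_mul]; ring
    _ ≤ |M i j| * (‖x‖ * ‖x‖) := by
        gcongr
        · exact norm_le_pi_norm x i
        · exact norm_le_pi_norm x j
    _ = _ := by ring

lemma exists_quad_le_of_tendsto {M : ℕ → Matrix ι ι ℝ} {N : Matrix ι ι ℝ}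
    (h : Tendsto M atTop (𝓝 N)) : ∃ p, ∀ k x, x ⬝ᵥ M k *ᵥ x ≤ p * ‖x‖ ^ 2 := by
  have hc : Continuous fun M : Matrix ι ι ℝ => ∑ i, ∑ j, |M i j| :=
    continuous_finsetSum _ fun i _ => continuous_finsetSum _ fun j _ =>
      (continuous_apply_apply i j).abs
  obtain ⟨p, hp⟩ := ((hc.tendsto N).comp h).bddAbove_range
  refine ⟨p, fun k x => (quad_le_sum_abs_mul _ x).trans ?_⟩
  gcongr
  exact hp ⟨k, rfl⟩

/-- The form attains a positive minimum on the compact unit sphere, and homogeneity extends the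
bound to all vectors. -/
lemma exists_le_quad_of_posDef {G : Matrix ι ι ℝ} (hG : G.PosDef) :
    ∃ g > 0, ∀ x, g * ‖x‖ ^ 2 ≤ x ⬝ᵥ G *ᵥ x := by
  cases isEmpty_or_nonempty ι
  · exact ⟨1, one_pos, fun x => by simp [Subsingleton.elim x 0]⟩
  have hc : Continuous fun x : ι → ℝ => x ⬝ᵥ G *ᵥ x := by fun_prop
  obtain ⟨u, hu, hmin⟩ := (isCompact_sphere (0 : ι → ℝ) 1).exists_isMinOn
    (NormedSpace.sphere_nonempty.2 zero_le_one) hc.continuousOn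
  have hu0 : u ≠ 0 := by
    rintro rfl
    simp at hu
  refine ⟨_, posDef_quad_pos hG hu0, fun x => ?_⟩
  by_cases hx : x = 0
  · simp [hx]
  have hx' : ‖x‖ ≠ 0 := norm_ne_zero_iff.2 hx
  have h1 := hmin (a := ‖x‖⁻¹ • x) (by simp [norm_smul, hx'])
  simp only [Set.mem_ofPred_eq, Matrix.mulVec_smul, dotProduct_smul, smul_dotProduct,
    smul_eq_mul] at h1
  calc _ ≤ (‖x‖⁻¹ * (‖x‖⁻¹ * (x ⬝ᵥ G *ᵥ x))) * ‖x‖ ^ 2 := by gcongr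
    _ = _ := by field_simp

/-- Transition matrices of a time-varying system with a strict, bounded Lyapunov function decay
geometrically. -/
lemma exists_geometric_decay [DecidableEq ι] {G : Matrix ι ι ℝ} (hG : G.PosDef)
    {P A M : ℕ → Matrix ι ι ℝ} {p : ℝ} (hP : ∀ k, (P k - G).PosSemidef)
    (hb : ∀ k x, x ⬝ᵥ P k *ᵥ x ≤ p * ‖x‖ ^ 2)
    (hstep : ∀ k, (P (k + 1) - (A k * P k * (A k)ᵀ + G)).PosSemidef)
    (hM0 : M 0 = 1) (hM : ∀ k, M (k + 1) = A k * M k) :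
    ∃ b r : ℝ, 0 ≤ r ∧ r < 1 ∧ ∀ k i j, |M k i j| ≤ b * r ^ k := by
  obtain ⟨g, hg, hgG⟩ := exists_le_quad_of_posDef hG
  -- Raising the upper bound to at least g keeps the contraction factor s = 1 - g/p' nonnegative.
  set p' := max p g with hp'
  have hp0 : 0 < p' := lt_max_of_lt_right hg
  have hb' : ∀ k x, x ⬝ᵥ P k *ᵥ x ≤ p' * ‖x‖ ^ 2 := fun k x =>
    (hb k x).trans (by gcongr; exact le_max_left _ _)
  set s := 1 - g / p' with hs
  have hs0 : 0 ≤ s := sub_nonneg.2 ((div_le_one hp0).2 (le_max_right _ _))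
  have hs1 : s < 1 := sub_lt_self _ (div_pos hg hp0)
  -- The form P is a Lyapunov function of the transposed system: since G ≥ g‖·‖² ≥ (g/p') P[k+1],
  -- the inequality P[k+1] ≥ A P Aᵀ + G yields A P Aᵀ ≤ s P[k+1].
  have key : ∀ k x, ((M k)ᵀ *ᵥ x) ⬝ᵥ P 0 *ᵥ ((M k)ᵀ *ᵥ x) ≤ s ^ k * (x ⬝ᵥ P k *ᵥ x) := by
    intro k
    induction k with
    | zero => simp [hM0]
    | succ k ih =>
      intro x
      rw [hM, Matrix.transpose_mul, ← Matrix.mulVec_mulVec]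
      refine (ih _).trans ?_
      rw [← quad_conj, pow_succ, mul_assoc (s ^ k)]
      gcongr
      have h1 := quad_le_of_posSemidef_sub (hstep k) x
      rw [Matrix.add_mulVec, dotProduct_add] at h1
      have h2 := hgG x
      have h3 : g / p' * (x ⬝ᵥ P (k + 1) *ᵥ x) ≤ g * ‖x‖ ^ 2 := by
        calc _ ≤ g / p' * (p' * ‖x‖ ^ 2) := by gcongr; exact hb' _ _
          _ = _ := by field_simp
      rw [hs, sub_mul, one_mul]
      linarith
  refine ⟨√(p' / g), √s, Real.sqrt_nonneg _, ?_, fun k i j => ?_⟩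
  · rw [Real.sqrt_lt' one_pos]
    simpa using hs1
  · refine abs_le_of_sq_le_sq ?_ (by positivity)
    rw [mul_pow, Real.sq_sqrt (by positivity), ← pow_mul, mul_comm k 2, pow_mul, Real.sq_sqrt hs0]
    have h1 := hgG ((M k)ᵀ *ᵥ Pi.single i 1)
    have h2 := quad_le_of_posSemidef_sub (hP 0) ((M k)ᵀ *ᵥ Pi.single i 1)
    have h3 := key k (Pi.single i 1)
    have h4 := hb' k (Pi.single i 1)
    rw [Pi.norm_single, norm_one, one_pow, mul_one] at h4
    have h5 : M k i j ^ 2 ≤ ‖(M k)ᵀ *ᵥ Pi.single i 1‖ ^ 2 := by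
      have := norm_le_pi_norm ((M k)ᵀ *ᵥ Pi.single i 1) j
      rw [← sq_abs]
      gcongr
      simpa using this
    have h6 : g * M k i j ^ 2 ≤ s ^ k * p' :=
      calc _ ≤ g * ‖(M k)ᵀ *ᵥ Pi.single i 1‖ ^ 2 := by gcongr
        _ ≤ _ := (h1.trans h2).trans h3
        _ ≤ _ := by gcongr
    rw [div_mul_eq_mul_div, le_div_iff₀ hg]
    linarith

end QuadraticForms

/-! ### The Riccati recursion -/

section Riccati

set_option linter.unusedSectionVars false

variable {ι κ : Type*} [Fintype ι] [DecidableEq ι] [Fintype κ] [DecidableEq κ]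

/-- The Kalman gain at the prior covariance `P`. -/
noncomputable def kalmanGain (C : Matrix κ ι ℝ) (R : Matrix κ κ ℝ) (P : Matrix ι ι ℝ) :
    Matrix ι κ ℝ :=
  P * Cᵀ * (C * P * Cᵀ + R)⁻¹

/-- One step of the Riccati recursion of the prior covariance. -/
noncomputable def riccati (A : Matrix ι ι ℝ) (C : Matrix κ ι ℝ) (R : Matrix κ κ ℝ)
    (G P : Matrix ι ι ℝ) : Matrix ι ι ℝ :=
  A * ((1 - kalmanGain C R P * C) * P) * Aᵀ + G

/-- The prior covariance after one step with the fixed gain `L` in place of the Kalman gain. -/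
def gainCov (A : Matrix ι ι ℝ) (C : Matrix κ ι ℝ) (R : Matrix κ κ ℝ)
    (G : Matrix ι ι ℝ) (L : Matrix ι κ ℝ) (P : Matrix ι ι ℝ) : Matrix ι ι ℝ :=
  A * (1 - L * C) * P * (A * (1 - L * C))ᵀ + (A * (L * R * Lᵀ) * Aᵀ + G)

variable {A : Matrix ι ι ℝ} {C : Matrix κ ι ℝ} {R : Matrix κ κ ℝ} {G P P' : Matrix ι ι ℝ}

lemma innovation_posDef (hR : R.PosDef) (hP : P.PosSemidef) : (C * P * Cᵀ + R).PosDef :=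
  hR.posSemidef_add (posSemidef_conj hP C)

lemma kalmanGain_mul_innovation (hR : R.PosDef) (hP : P.PosSemidef) :
    kalmanGain C R P * (C * P * Cᵀ + R) = P * Cᵀ := by
  have h := (Matrix.isUnit_iff_isUnit_det _).1 (innovation_posDef (C := C) hR hP).isUnit
  rw [kalmanGain, Matrix.mul_assoc, Matrix.nonsing_inv_mul _ h, Matrix.mul_one]

lemma innovation_mul_kalmanGain_transpose (hR : R.PosDef) (hP : P.PosSemidef) :
    (C * P * Cᵀ + R) * (kalmanGain C R P)ᵀ = C * P := by
  have h := congrArg Matrix.transpose (kalmanGain_mul_innovation (C := C) hR hP)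
  rwa [Matrix.transpose_mul, posSemidef_symm (innovation_posDef hR hP).posSemidef,
    Matrix.transpose_mul, Matrix.transpose_transpose, posSemidef_symm hP] at h

/-- Completion of the square in the gain. -/
lemma posterior_completion (hR : R.PosDef) (hP : P.PosSemidef) (L : Matrix ι κ ℝ) :
    (1 - L * C) * P * (1 - L * C)ᵀ + L * R * Lᵀ = (1 - kalmanGain C R P * C) * P +
      (L - kalmanGain C R P) * (C * P * Cᵀ + R) * (L - kalmanGain C R P)ᵀ := by
  have h1 := kalmanGain_mul_innovation (C := C) hR hP
  have h2 := innovation_mul_kalmanGain_transpose (C := C) hR hP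
  set H := kalmanGain C R P
  set S := C * P * Cᵀ + R with hS
  have h3 : (L - H) * S * (L - H)ᵀ = L * S * Lᵀ - L * (S * Hᵀ) - (H * S) * Lᵀ + H * (S * Hᵀ) := by
    simp only [Matrix.transpose_sub, Matrix.sub_mul, Matrix.mul_sub, Matrix.mul_assoc]
    abel
  rw [h3, h1, h2, hS]
  simp only [Matrix.transpose_sub, Matrix.transpose_mul, Matrix.transpose_one, Matrix.sub_mul,
    Matrix.mul_sub, Matrix.mul_assoc, Matrix.mul_add, Matrix.add_mul, Matrix.one_mul,
    Matrix.mul_one]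
  abel

lemma gainCov_eq (hR : R.PosDef) (hP : P.PosSemidef) (L : Matrix ι κ ℝ) :
    gainCov A C R G L P = riccati A C R G P + A * ((L - kalmanGain C R P) * (C * P * Cᵀ + R) *
      (L - kalmanGain C R P)ᵀ) * Aᵀ := by
  have h := posterior_completion (C := C) hR hP L
  have h2 : gainCov A C R G L P =
      A * ((1 - L * C) * P * (1 - L * C)ᵀ + L * R * Lᵀ) * Aᵀ + G := by
    rw [gainCov, Matrix.transpose_mul]
    simp only [Matrix.mul_add, Matrix.add_mul, Matrix.mul_assoc, add_assoc]
  rw [h2, h, riccati]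
  simp only [Matrix.mul_add, Matrix.add_mul]
  abel

lemma riccati_eq_gainCov (hR : R.PosDef) (hP : P.PosSemidef) :
    riccati A C R G P = gainCov A C R G (kalmanGain C R P) P := by
  simp [gainCov_eq hR hP]

lemma riccati_le_gainCov (hR : R.PosDef) (hP : P.PosSemidef) (L : Matrix ι κ ℝ) :
    (gainCov A C R G L P - riccati A C R G P).PosSemidef := by
  rw [gainCov_eq hR hP, add_sub_cancel_left]
  exact posSemidef_conj (posSemidef_conj (innovation_posDef hR hP).posSemidef _) A

lemma gainCov_sub (L : Matrix ι κ ℝ) : gainCov A C R G L P' - gainCov A C R G L P =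
    A * (1 - L * C) * (P' - P) * (A * (1 - L * C))ᵀ := by
  simp only [gainCov, Matrix.mul_sub, Matrix.sub_mul]
  abel

lemma gainCov_mono (h : (P' - P).PosSemidef) (L : Matrix ι κ ℝ) :
    (gainCov A C R G L P' - gainCov A C R G L P).PosSemidef := by
  rw [gainCov_sub]
  exact posSemidef_conj h _

lemma posterior_posSemidef (hR : R.PosDef) (hP : P.PosSemidef) :
    ((1 - kalmanGain C R P * C) * P).PosSemidef := by
  have h := posterior_completion (C := C) hR hP (kalmanGain C R P)
  rw [sub_self, Matrix.zero_mul, Matrix.zero_mul, add_zero] at h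
  rw [← h]
  exact (posSemidef_conj hP _).add (posSemidef_conj hR.posSemidef _)

lemma posterior_eq_mul (hR : R.PosDef) (hP : P.PosSemidef) :
    (1 - kalmanGain C R P * C) * P = P * (1 - Cᵀ * (kalmanGain C R P)ᵀ) := by
  rw [← posSemidef_symm (posterior_posSemidef (C := C) hR hP)]
  simp [Matrix.transpose_mul, posSemidef_symm hP]

lemma riccati_sub_posSemidef (hR : R.PosDef) (hP : P.PosSemidef) :
    (riccati A C R G P - G).PosSemidef := by
  rw [riccati, add_sub_cancel_right]
  exact posSemidef_conj (posterior_posSemidef hR hP) A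

lemma riccati_posSemidef (hR : R.PosDef) (hG : G.PosSemidef) (hP : P.PosSemidef) :
    (riccati A C R G P).PosSemidef :=
  (posSemidef_conj (posterior_posSemidef hR hP) A).add hG

/-- The Riccati map is the minimum over gains L of the monotone affine maps `gainCov`, attained at
the Kalman gain. Fixing the gain optimal for the larger covariance compares the two values. -/
lemma riccati_mono (hR : R.PosDef) (hP : P.PosSemidef) (hP' : P'.PosSemidef)
    (h : (P' - P).PosSemidef) : (riccati A C R G P' - riccati A C R G P).PosSemidef := by
  have h1 := gainCov_mono (A := A) (C := C) (R := R) (G := G) h (kalmanGain C R P')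
  rw [← riccati_eq_gainCov hR hP'] at h1
  simpa using h1.add (riccati_le_gainCov (A := A) (C := C) (G := G) hR hP (kalmanGain C R P'))

/-- Discarding the measurement noise term leaves the Lyapunov inequality required by
`exists_geometric_decay`. -/
lemma riccati_step_posSemidef (hR : R.PosDef) (hP : P.PosSemidef) :
    (riccati A C R G P - (A * (1 - kalmanGain C R P * C) * P * (A * (1 - kalmanGain C R P * C))ᵀ
      + G)).PosSemidef := by
  rw [riccati_eq_gainCov hR hP, gainCov, add_sub_add_left_eq_sub, add_sub_cancel_right]
  exact posSemidef_conj (posSemidef_conj hR.posSemidef _) A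

lemma continuousAt_kalmanGain (hR : R.PosDef) (hP : P.PosSemidef) :
    ContinuousAt (fun P => (C * P * Cᵀ + R)⁻¹) P := by
  simp_rw [Matrix.inv_def, Ring.inverse_eq_inv']
  have h := (Matrix.isUnit_iff_isUnit_det _).1 (innovation_posDef (C := C) hR hP).isUnit
  have h1 : Continuous fun P : Matrix ι ι ℝ => C * P * Cᵀ + R := by fun_prop
  exact (h1.matrix_det.continuousAt.inv₀ h.ne_zero).smul h1.matrix_adjugate.continuousAt

/-- The closed-loop matrix of the error dynamics of the stationary Kalman filter is stable. -/
lemma tendsto_pow_of_riccati_eq (hR : R.PosDef) (hG : G.PosDef) (hP : P.PosSemidef)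
    (hfix : riccati A C R G P = P) :
    Tendsto (fun k => (A * (1 - kalmanGain C R P * C)) ^ k) atTop (𝓝 0) := by
  have hstep := riccati_step_posSemidef (A := A) (C := C) (G := G) hR hP
  have hlow := riccati_sub_posSemidef (A := A) (C := C) (G := G) hR hP
  rw [hfix] at hstep hlow
  obtain ⟨b, r, hr0, hr1, h⟩ := exists_geometric_decay hG (P := fun _ => P)
    (A := fun _ => A * (1 - kalmanGain C R P * C))
    (M := fun k => (A * (1 - kalmanGain C R P * C)) ^ k) (fun _ => hlow)
    (fun _ => quad_le_sum_abs_mul P) (fun _ => hstep) (pow_zero _) (fun k => pow_succ' _ _)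
  exact tendsto_zero_of_geometric hr0 hr1 h

/-- Detectability, positive definite noises: the Riccati recursion converges from every initial
covariance, to a fixed point. -/
theorem riccati_tendsto (hR : R.PosDef) (hG : G.PosDef) {L : Matrix ι κ ℝ}
    (hL : A * (1 - L * C) * (A * (1 - L * C)) = 0) :
    ∃ Ps, Ps.PosSemidef ∧ riccati A C R G Ps = Ps ∧
      ∀ X : ℕ → Matrix ι ι ℝ, (X 0).PosSemidef → (∀ k, X (k + 1) = riccati A C R G (X k)) →
        Tendsto X atTop (𝓝 Ps) := by
  have hpsd {X : ℕ → Matrix ι ι ℝ} (h0 : (X 0).PosSemidef)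
      (hX : ∀ k, X (k + 1) = riccati A C R G (X k)) (k : ℕ) : (X k).PosSemidef := by
    cases k with
    | zero => exact h0
    | succ k =>
      induction k with
      | zero => rw [hX]; exact riccati_posSemidef hR hG.posSemidef h0
      | succ k ih => rw [hX]; exact riccati_posSemidef hR hG.posSemidef ih
  -- The iterates from zero increase, so an upper bound suffices for their convergence; they also
  -- bound from below the iterates from any other start.
  let Z : ℕ → Matrix ι ι ℝ := fun k => (riccati A C R G)^[k] 0
  have hZ : ∀ k, Z (k + 1) = riccati A C R G (Z k) := fun k => Function.iterate_succ_apply' _ _ _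
  have hZ0 : Z 0 = 0 := rfl
  have hZpsd : ∀ k, (Z k).PosSemidef := hpsd (by rw [hZ0]; exact .zero) hZ
  have hmono : ∀ k, (Z (k + 1) - Z k).PosSemidef := by
    intro k
    induction k with
    | zero => rw [hZ0, sub_zero]; exact hZpsd 1
    | succ k ih => rw [hZ (k + 1), hZ k]; rw [hZ k] at ih; exact
        riccati_mono hR (hZpsd k) (hZ k ▸ hZpsd (k + 1)) ih
  set D := A * (1 - L * C)
  set N := A * (L * R * Lᵀ) * Aᵀ + G
  have hN : N.PosSemidef := (posSemidef_conj (posSemidef_conj hR.posSemidef _) A).add hG.posSemidef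
  -- Since D² = 0, the covariance recursion with gain L becomes constant after two steps. Its value
  -- U is a fixed point of `gainCov`, and suboptimality of L makes it an upper bound for every `Z
  -- k`.
  set U := D * N * Dᵀ + N
  have hU : U.PosSemidef := (posSemidef_conj hN D).add hN
  have hUfix : gainCov A C R G L U = U := by
    change D * (D * N * Dᵀ + N) * Dᵀ + N = D * N * Dᵀ + N
    rw [Matrix.mul_add, ← Matrix.mul_assoc, ← Matrix.mul_assoc, hL, Matrix.zero_mul,
      Matrix.zero_mul, zero_add]
  have hbound : ∀ k, (U - Z k).PosSemidef := by
    intro k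
    induction k with
    | zero => rw [hZ0, sub_zero]; exact hU
    | succ k ih =>
      have h1 := riccati_mono (A := A) (C := C) (G := G) hR (hZpsd k) hU ih
      have h2 := riccati_le_gainCov (A := A) (C := C) (G := G) hR hU L
      rw [hUfix] at h2
      rw [hZ]
      simpa using h2.add h1
  obtain ⟨Ps, hPs⟩ : ∃ Ps, Tendsto Z atTop (𝓝 Ps) := by
    refine exists_tendsto_of_quad (fun k => posSemidef_symm (hZpsd k)) fun x => ?_
    have hm : Monotone fun k => x ⬝ᵥ Z k *ᵥ x :=
      monotone_nat_of_le_succ fun k => quad_le_of_posSemidef_sub (hmono k) x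
    exact ⟨_, tendsto_atTop_ciSup hm
      ⟨x ⬝ᵥ U *ᵥ x, by rintro _ ⟨k, rfl⟩; exact quad_le_of_posSemidef_sub (hbound k) x⟩⟩
  have hPspsd : Ps.PosSemidef := posSemidef_of_tendsto hPs hZpsd
  have hfix : riccati A C R G Ps = Ps := by
    have hinv := continuousAt_kalmanGain (C := C) hR hPspsd
    have hc : ContinuousAt (riccati A C R G) Ps := by
      unfold riccati kalmanGain
      fun_prop
    have h1 := (tendsto_add_atTop_iff_nat 1).2 hPs
    simp_rw [hZ] at h1
    exact tendsto_nhds_unique (hc.tendsto.comp hPs) h1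
  refine ⟨Ps, hPspsd, hfix, fun X hX0 hX => ?_⟩
  have hXpsd := hpsd hX0 hX
  set H := kalmanGain C R Ps
  set F := A * (1 - H * C) with hF
  have hlow : ∀ k, (X k - Z k).PosSemidef := by
    intro k
    induction k with
    | zero => rw [hZ0, sub_zero]; exact hX0
    | succ k ih => rw [hX, hZ]; exact riccati_mono hR (hZpsd k) (hXpsd k) ih
  have hgfix : gainCov A C R G H Ps = Ps := by rw [← riccati_eq_gainCov hR hPspsd, hfix]
  -- Upper bound: use the limiting gain H at all times instead of the optimal one. The recursion is
  -- then affine with fixed point `Ps`, and F^k → 0 closes the squeeze.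
  have hup : ∀ k, (Ps + F ^ k * (X 0 - Ps) * (F ^ k)ᵀ - X k).PosSemidef := by
    intro k
    induction k with
    | zero => simpa using Matrix.PosSemidef.zero
    | succ k ih =>
      have h1 := gainCov_mono (A := A) (C := C) (R := R) (G := G) ih H
      have h2 := riccati_le_gainCov (A := A) (C := C) (G := G) hR (hXpsd k) H
      rw [← hX] at h2
      have h3 : gainCov A C R G H (Ps + F ^ k * (X 0 - Ps) * (F ^ k)ᵀ) =
          Ps + F ^ (k + 1) * (X 0 - Ps) * (F ^ (k + 1))ᵀ := by
        have h4 := gainCov_sub (A := A) (C := C) (R := R) (G := G) (P := Ps)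
          (P' := Ps + F ^ k * (X 0 - Ps) * (F ^ k)ᵀ) H
        rw [hgfix, add_sub_cancel_left, sub_eq_iff_eq_add'] at h4
        rw [h4, ← hF, pow_succ', Matrix.transpose_mul F (F ^ k)]
        simp only [Matrix.mul_assoc]
      rw [← h3]
      simpa using h1.add h2
  have hFpow : Tendsto (fun k => F ^ k) atTop (𝓝 0) := tendsto_pow_of_riccati_eq hR hG hPspsd hfix
  refine tendsto_of_quad (fun k => posSemidef_symm (hXpsd k)) (posSemidef_symm hPspsd) fun x => ?_
  refine tendsto_of_tendsto_of_tendsto_of_le_of_le (tendsto_quad hPs x) ?_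
    (fun k => quad_le_of_posSemidef_sub (hlow k) x) (fun k => quad_le_of_posSemidef_sub (hup k) x)
  refine tendsto_quad ?_ x
  have hc : Continuous fun M : Matrix ι ι ℝ => Ps + M * (X 0 - Ps) * Mᵀ := by fun_prop
  simpa [Function.comp_def] using (hc.tendsto 0).comp hFpow

end Riccati

/-! ### Linear systems driven by white Gaussian noise -/

section Noise

variable {Ω : Type*} [MeasurableSpace Ω] {P : Measure Ω}

lemma IsWhiteGaussian.memLp {κ : Type*} [Fintype κ] {ν : ℕ → Ω → κ → ℝ} {S : Matrix κ κ ℝ}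
    (h : IsWhiteGaussian ν S P) (k : ℕ) (a : κ) : MemLp (fun ω => ν k ω a) 2 P :=
  ((h.gaussian.hasGaussianLaw_eval k).map_fun (ContinuousLinearMap.proj a)).memLp_two

/-- Independent white Gaussian noises are jointly a white Gaussian noise. -/
lemma IsWhiteGaussian.sumElim {κ₁ κ₂ : Type*} [Fintype κ₁] [Fintype κ₂] {v : ℕ → Ω → κ₁ → ℝ}
    {w : ℕ → Ω → κ₂ → ℝ} {Q : Matrix κ₁ κ₁ ℝ} {R : Matrix κ₂ κ₂ ℝ}
    (hv : IsWhiteGaussian v Q P) (hw : IsWhiteGaussian w R P)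
    (hvw : IndepFun (fun ω k => v k ω) (fun ω k => w k ω) P) :
    IsWhiteGaussian (fun k ω => Sum.elim (v k ω) (w k ω)) (Matrix.fromBlocks Q 0 0 R) P := by
  have hcross : ∀ k l a b, ∫ ω, v k ω a * w l ω b ∂P = 0 := by
    intro k l a b
    have h1 : IndepFun (fun ω => v k ω a) (fun ω => w l ω b) P :=
      hvw.comp (φ := fun f : ℕ → κ₁ → ℝ => f k a) (ψ := fun f : ℕ → κ₂ → ℝ => f l b)
        (by fun_prop) (by fun_prop)
    rw [h1.integral_fun_mul_eq_mul_integral (hv.memLp k a).aestronglyMeasurable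
      (hw.memLp l b).aestronglyMeasurable, hv.mean, zero_mul]
  refine ⟨⟨fun I => ?_⟩, ?_, ?_⟩
  · have h1 : IndepFun (fun ω => I.restrict fun k => v k ω)
        (fun ω => I.restrict fun k => w k ω) P :=
      hvw.comp (φ := I.restrict) (ψ := I.restrict) (Finset.measurable_restrict I)
        (Finset.measurable_restrict I)
    have h2 := h1.hasGaussianLaw (hv.gaussian.hasGaussianLaw I) (hw.gaussian.hasGaussianLaw I)
    let L : ((I → κ₁ → ℝ) × (I → κ₂ → ℝ)) →L[ℝ] (I → κ₁ ⊕ κ₂ → ℝ) :=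
      LinearMap.toContinuousLinearMap
        { toFun := fun p i => Sum.elim (p.1 i) (p.2 i)
          map_add' := fun p p' => by ext i (a | a) <;> simp
          map_smul' := fun c p => by ext i (a | a) <;> simp }
    exact h2.map_fun L
  · rintro k (a | a)
    · exact hv.mean k a
    · exact hw.mean k a
  · rintro k l (a | a) (b | b)
    · simpa using hv.cov k l a b
    · simpa using hcross k l a b
    · simpa [mul_comm] using hcross l k b a
    · simpa using hw.cov k l a b

/-- Affine images of a Gaussian process form a Gaussian process. -/
lemma isGaussianProcess_affine {ι κ : Type*} [Fintype ι] [Fintype κ] {ν : ℕ → Ω → κ → ℝ}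
    (h : IsGaussianProcess ν P) (c : ℕ → ι → ℝ) (I : ℕ → Finset ℕ) (D : ℕ → ℕ → Matrix ι κ ℝ) :
    IsGaussianProcess (fun k ω => c k + ∑ j ∈ I k, D k j *ᵥ ν j ω) P := by
  have h1 : IsGaussianProcess (fun k ω => ∑ j ∈ I k, D k j *ᵥ ν j ω) P := by
    refine IsGaussianProcess.of_isGaussianProcess h fun k => ⟨I k, ∑ j : I k,
      (LinearMap.toContinuousLinearMap (D k j).mulVecLin) ∘L ContinuousLinearMap.proj j,
      fun ω => ?_⟩
    rw [← Finset.sum_coe_sort]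
    simp
  refine ⟨fun J => ⟨?_⟩⟩
  have h2 := (h1.hasGaussianLaw J).isGaussian_map
  have h3 : P.map (fun ω => J.restrict fun k => c k + ∑ j ∈ I k, D k j *ᵥ ν j ω) =
      (P.map (fun ω => J.restrict fun k => ∑ j ∈ I k, D k j *ᵥ ν j ω)).map
        (fun x => (J.restrict c) + x) := by
    rw [AEMeasurable.map_map_of_aemeasurable (by fun_prop) (h1.hasGaussianLaw J).aemeasurable]
    rfl
  rw [h3]
  infer_instance

end Noise

section CrossMoment

variable {Ω : Type*} [MeasurableSpace Ω] {P : Measure Ω}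

/-- The matrix `𝔼[X Yᵀ]`. -/
noncomputable def crossMoment {ι κ : Type*} (P : Measure Ω) (X : Ω → ι → ℝ) (Y : Ω → κ → ℝ) :
    Matrix ι κ ℝ :=
  Matrix.of fun a b => ∫ ω, X ω a * Y ω b ∂P

variable {ι κ μ : Type*} [Fintype ι] [Fintype κ] {X X' : Ω → ι → ℝ} {Y : Ω → κ → ℝ}

omit [Fintype ι] [Fintype κ] in
lemma crossMoment_transpose (X : Ω → ι → ℝ) (Y : Ω → κ → ℝ) :
    (crossMoment P X Y)ᵀ = crossMoment P Y X := by
  ext a b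
  simp [crossMoment, mul_comm]

omit [Fintype ι] [Fintype κ] in
lemma crossMoment_add_left (hX : ∀ a, MemLp (fun ω => X ω a) 2 P)
    (hX' : ∀ a, MemLp (fun ω => X' ω a) 2 P) (hY : ∀ a, MemLp (fun ω => Y ω a) 2 P) :
    crossMoment P (fun ω => X ω + X' ω) Y = crossMoment P X Y + crossMoment P X' Y := by
  ext a b
  simp only [crossMoment, Matrix.of_apply, Pi.add_apply, Matrix.add_apply, add_mul]
  exact integral_add ((hX a).integrable_mul (hY b)) ((hX' a).integrable_mul (hY b))

omit [Fintype κ] in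
lemma crossMoment_mulVec_left (A : Matrix μ ι ℝ) (hX : ∀ a, MemLp (fun ω => X ω a) 2 P)
    (hY : ∀ a, MemLp (fun ω => Y ω a) 2 P) :
    crossMoment P (fun ω => A *ᵥ X ω) Y = A * crossMoment P X Y := by
  ext a b
  simp only [crossMoment, Matrix.of_apply, Matrix.mul_apply, Matrix.mulVec, dotProduct,
    Finset.sum_mul, mul_assoc]
  have h i : Integrable (fun ω => A a i * (X ω i * Y ω b)) P :=
    ((hX i).integrable_mul (hY b)).const_mul (A a i)
  rw [integral_finsetSum _ fun i _ => h i]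
  simp_rw [integral_const_mul]

omit [Fintype ι] in
lemma crossMoment_mulVec_right (A : Matrix μ κ ℝ) (hX : ∀ a, MemLp (fun ω => X ω a) 2 P)
    (hY : ∀ a, MemLp (fun ω => Y ω a) 2 P) :
    crossMoment P X (fun ω => A *ᵥ Y ω) = crossMoment P X Y * Aᵀ := by
  rw [← crossMoment_transpose, crossMoment_mulVec_left A hY hX, Matrix.transpose_mul,
    crossMoment_transpose]

lemma memLp_mulVec (A : Matrix μ ι ℝ) (hX : ∀ a, MemLp (fun ω => X ω a) 2 P) (b : μ) :
    MemLp (fun ω => (A *ᵥ X ω) b) 2 P :=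
  memLp_finsetSum _ fun i _ => (hX i).const_mul (A b i)

lemma integral_mulVec (A : Matrix μ ι ℝ) (hX : ∀ a, Integrable (fun ω => X ω a) P) (b : μ) :
    ∫ ω, (A *ᵥ X ω) b ∂P = (A *ᵥ fun a => ∫ ω, X ω a ∂P) b := by
  simp only [Matrix.mulVec, dotProduct]
  rw [integral_finsetSum _ fun i _ => (hX i).const_mul (A b i)]
  simp_rw [integral_const_mul]

end CrossMoment

/-- The transition matrices `F (j - 1) ⋯ F 0` of a time-varying linear system. -/
def transition {ι : Type*} [Fintype ι] [DecidableEq ι] (F : ℕ → Matrix ι ι ℝ) : ℕ → Matrix ι ι ℝ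
  | 0 => 1
  | j + 1 => F j * transition F j

/-- The covariance accumulated from time `0` on by a linear system driven by white noise whose
covariance, seen from the state, is `D`. -/
def accumulatedCov {ι : Type*} [Fintype ι] (F : ℕ → Matrix ι ι ℝ) (D : Matrix ι ι ℝ) :
    ℕ → Matrix ι ι ℝ
  | 0 => 0
  | j + 1 => F j * accumulatedCov F D j * (F j)ᵀ + D

/-- `z` is the response of the linear system `z[k+1] = F[k] z[k] + B ν[k]` from the state `z₀`. -/
structure IsResponse {Ω ι κ : Type*} [Fintype ι] [Fintype κ] (F : ℕ → Matrix ι ι ℝ)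
    (B : Matrix ι κ ℝ) (ν : ℕ → Ω → κ → ℝ) (z₀ : ι → ℝ) (z : ℕ → Ω → ι → ℝ) : Prop where
  init : ∀ ω, z 0 ω = z₀
  step : ∀ k ω, z (k + 1) ω = F k *ᵥ z k ω + B *ᵥ ν k ω

namespace IsResponse

variable {Ω : Type*} [MeasurableSpace Ω] {P : Measure Ω} [IsProbabilityMeasure P]
  {ι κ : Type*} [Fintype ι] [DecidableEq ι] [Fintype κ]
  {F : ℕ → Matrix ι ι ℝ} {B : Matrix ι κ ℝ} {ν : ℕ → Ω → κ → ℝ} {S : Matrix κ κ ℝ} {z₀ : ι → ℝ}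
  {z : ℕ → Ω → ι → ℝ}

omit [MeasurableSpace Ω] [DecidableEq ι] in
lemma exists_eq_sum (h : IsResponse F B ν z₀ z) (k : ℕ) :
    ∃ (c : ι → ℝ) (D : ℕ → Matrix ι κ ℝ), ∀ ω,
      z k ω = c + ∑ j ∈ Finset.range k, D j *ᵥ ν j ω := by
  induction k with
  | zero => exact ⟨z₀, 0, fun ω => by simp [h.init]⟩
  | succ k ih =>
    obtain ⟨c, D, hD⟩ := ih
    refine ⟨F k *ᵥ c, fun j => if j = k then B else F k * D j, fun ω => ?_⟩
    rw [h.step, hD, Matrix.mulVec_add, Matrix.mulVec_sum, Finset.sum_range_succ, add_assoc]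
    congr 2
    · refine Finset.sum_congr rfl fun j hj => ?_
      simp [(Finset.mem_range.1 hj).ne]
    · simp

omit [IsProbabilityMeasure P] [DecidableEq ι] in
lemma gaussian {μ : Type*} [Fintype μ] (h : IsResponse F B ν z₀ z)
    (hν : IsWhiteGaussian ν S P) (L : Matrix μ ι ℝ) (f : ℕ → ℕ) :
    IsGaussianProcess (fun k ω => L *ᵥ z (f k) ω) P := by
  choose c D hD using h.exists_eq_sum
  convert isGaussianProcess_affine hν.gaussian (fun k => L *ᵥ c (f k))
    (fun k => Finset.range (f k)) (fun k j => L * D (f k) j) using 3 with k ω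
  simp_rw [hD, Matrix.mulVec_add, Matrix.mulVec_sum, Matrix.mulVec_mulVec]

omit [DecidableEq ι] in
lemma memLp (h : IsResponse F B ν z₀ z) (hν : IsWhiteGaussian ν S P) (k : ℕ) (a : ι) :
    MemLp (fun ω => z k ω a) 2 P := by
  induction k generalizing a with
  | zero => simp_rw [h.init]; exact memLp_const _
  | succ k ih =>
    simp_rw [h.step]
    exact (memLp_mulVec _ ih a).add (memLp_mulVec _ (hν.memLp k) a)

lemma mean (h : IsResponse F B ν z₀ z) (hν : IsWhiteGaussian ν S P) (k : ℕ) :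
    (fun a => ∫ ω, z k ω a ∂P) = transition F k *ᵥ z₀ := by
  induction k with
  | zero => simp [h.init, transition]
  | succ k ih =>
    ext a
    simp_rw [h.step, Pi.add_apply]
    rw [integral_add ((memLp_mulVec _ (h.memLp hν k) a).integrable one_le_two)
      ((memLp_mulVec _ (hν.memLp k) a).integrable one_le_two),
      integral_mulVec _ fun b => (h.memLp hν k b).integrable one_le_two,
      integral_mulVec _ fun b => (hν.memLp k b).integrable one_le_two, ih, transition,
      Matrix.mulVec_mulVec]
    simp [hν.mean, Matrix.mulVec, dotProduct]

-- The state at time k is a constant plus noises from times before k. Only zero mean and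
-- uncorrelatedness in time are used.
omit [DecidableEq ι] in
lemma crossMoment_noise (h : IsResponse F B ν z₀ z) (hν : IsWhiteGaussian ν S P) {k l : ℕ}
    (hkl : k ≤ l) : crossMoment P (z k) (ν l) = 0 := by
  induction k with
  | zero =>
    ext a b
    simp [crossMoment, h.init, integral_const_mul, hν.mean]
  | succ k ih =>
    have h1 : z (k + 1) = fun ω => F k *ᵥ z k ω + B *ᵥ ν k ω := funext (h.step k)
    have h2 : crossMoment P (ν k) (ν l) = 0 := by
      ext a b
      simp [crossMoment, hν.cov, (Nat.lt_of_succ_le hkl).ne]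
    rw [h1, crossMoment_add_left (memLp_mulVec _ (h.memLp hν k)) (memLp_mulVec _ (hν.memLp k))
      (hν.memLp l), crossMoment_mulVec_left _ (h.memLp hν k) (hν.memLp l),
      crossMoment_mulVec_left _ (hν.memLp k) (hν.memLp l), ih (by omega), h2]
    simp

omit [DecidableEq ι] in
lemma crossMoment_succ_left (h : IsResponse F B ν z₀ z) (hν : IsWhiteGaussian ν S P) {k l : ℕ}
    (hlk : l ≤ k) : crossMoment P (z (k + 1)) (z l) = F k * crossMoment P (z k) (z l) := by
  have h1 : z (k + 1) = fun ω => F k *ᵥ z k ω + B *ᵥ ν k ω := funext (h.step k)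
  have h2 : crossMoment P (ν k) (z l) = 0 := by
    rw [← crossMoment_transpose, h.crossMoment_noise hν hlk, Matrix.transpose_zero]
  rw [h1, crossMoment_add_left (memLp_mulVec _ (h.memLp hν k)) (memLp_mulVec _ (hν.memLp k))
    (h.memLp hν l), crossMoment_mulVec_left _ (h.memLp hν k) (h.memLp hν l),
    crossMoment_mulVec_left _ (hν.memLp k) (h.memLp hν l), h2, Matrix.mul_zero, add_zero]

omit [DecidableEq ι] in
lemma crossMoment_succ_self (h : IsResponse F B ν z₀ z) (hν : IsWhiteGaussian ν S P) (k : ℕ) :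
    crossMoment P (z (k + 1)) (z (k + 1)) =
      F k * crossMoment P (z k) (z k) * (F k)ᵀ + B * S * Bᵀ := by
  have h1 : z (k + 1) = fun ω => F k *ᵥ z k ω + B *ᵥ ν k ω := funext (h.step k)
  have hz := h.memLp hν
  have h2 : crossMoment P (ν k) (ν k) = S := by
    ext a b
    simp [crossMoment, hν.cov]
  have h3 : crossMoment P (ν k) (z (k + 1)) = S * Bᵀ := by
    rw [← crossMoment_transpose, h1, crossMoment_add_left (memLp_mulVec _ (hz k))
      (memLp_mulVec _ (hν.memLp k)) (hν.memLp k), crossMoment_mulVec_left _ (hz k) (hν.memLp k),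
      crossMoment_mulVec_left _ (hν.memLp k) (hν.memLp k), h.crossMoment_noise hν le_rfl,
      Matrix.mul_zero, zero_add, Matrix.transpose_mul, crossMoment_transpose, h2]
  have h4 : crossMoment P (z k) (z (k + 1)) = crossMoment P (z k) (z k) * (F k)ᵀ := by
    rw [← crossMoment_transpose, h.crossMoment_succ_left hν le_rfl, Matrix.transpose_mul,
      crossMoment_transpose]
  have h5 : crossMoment P (z (k + 1)) (z (k + 1)) = F k * crossMoment P (z k) (z (k + 1)) +
      B * crossMoment P (ν k) (z (k + 1)) := by
    rw [← crossMoment_mulVec_left _ (hz k) (hz _), ← crossMoment_mulVec_left _ (hν.memLp k) (hz _),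
      ← crossMoment_add_left (memLp_mulVec _ (hz k)) (memLp_mulVec _ (hν.memLp k)) (hz _), ← h1]
  rw [h5, h3, h4, Matrix.mul_assoc, Matrix.mul_assoc]

/-! ### Periodic systems sampled once per period -/

section Periodic

variable {m : ℕ}

lemma crossMoment_block (h : IsResponse F B ν z₀ z) (hν : IsWhiteGaussian ν S P)
    (hF : ∀ k j, F (m * k + j) = F j) (k j : ℕ) :
    crossMoment P (z (m * k + j)) (z (m * k + j)) =
      transition F j * crossMoment P (z (m * k)) (z (m * k)) * (transition F j)ᵀ +
        accumulatedCov F (B * S * Bᵀ) j := by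
  induction j with
  | zero => simp [transition, accumulatedCov]
  | succ j ih =>
    rw [← add_assoc, h.crossMoment_succ_self hν, ih, hF, transition, accumulatedCov,
      Matrix.transpose_mul]
    simp only [Matrix.mul_add, Matrix.add_mul, Matrix.mul_assoc, add_assoc]

lemma crossMoment_period (h : IsResponse F B ν z₀ z) (hν : IsWhiteGaussian ν S P)
    (hF : ∀ k j, F (m * k + j) = F j) (k : ℕ) :
    crossMoment P (z (m * (k + 1))) (z (m * (k + 1))) =
      transition F m * crossMoment P (z (m * k)) (z (m * k)) * (transition F m)ᵀ +
        accumulatedCov F (B * S * Bᵀ) m := by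
  rw [mul_add, mul_one, h.crossMoment_block hν hF]

lemma crossMoment_shift (h : IsResponse F B ν z₀ z) (hν : IsWhiteGaussian ν S P)
    (hF : ∀ k j, F (m * k + j) = F j) (k i : ℕ) :
    crossMoment P (z (m * (k + i))) (z (m * k)) =
      transition F m ^ i * crossMoment P (z (m * k)) (z (m * k)) := by
  have h1 : ∀ l ≥ k, ∀ j, crossMoment P (z (m * l + j)) (z (m * k)) =
      transition F j * crossMoment P (z (m * l)) (z (m * k)) := by
    intro l hl j
    induction j with
    | zero => simp [transition]
    | succ j ih =>
      have : m * k ≤ m * l := Nat.mul_le_mul_left m hl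
      rw [← add_assoc, h.crossMoment_succ_left hν (by omega), ih, hF, transition, Matrix.mul_assoc]
  induction i with
  | zero => simp
  | succ i ih =>
    rw [← add_assoc, mul_add m (k + i), mul_one, h1 _ (by omega), ih, pow_succ', Matrix.mul_assoc]

lemma _root_.ClockSync.transition_period (hF : ∀ k j, F (m * k + j) = F j) (k : ℕ) :
    transition F (m * k) = transition F m ^ k := by
  have h1 : ∀ k j, transition F (m * k + j) = transition F j * transition F (m * k) := by
    intro k j
    induction j with
    | zero => simp [transition]
    | succ j ih => rw [← add_assoc, transition, ih, hF, transition, Matrix.mul_assoc]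
  induction k with
  | zero => simp [transition]
  | succ k ih => rw [mul_add, mul_one, h1, ih, pow_succ']

lemma exists_tendsto_crossMoment (h : IsResponse F B ν z₀ z) (hν : IsWhiteGaussian ν S P)
    (hF : ∀ k j, F (m * k + j) = F j)
    (hstab : Tendsto (fun k => transition F m ^ k) atTop (𝓝 0)) :
    ∃ Y, Tendsto (fun k => crossMoment P (z (m * k)) (z (m * k))) atTop (𝓝 Y) :=
  exists_tendsto_of_affine_recursion hstab (h.crossMoment_period hν hF)

/-- Outputs of a stable periodic linear system driven by white Gaussian noise, sampled once per
period, are zero-mean stationary Gaussian in steady state. -/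
theorem isSteadyStationary {μ : Type*} [Fintype μ] (h : IsResponse F B ν z₀ z)
    (hν : IsWhiteGaussian ν S P) (hF : ∀ k j, F (m * k + j) = F j)
    (hstab : Tendsto (fun k => transition F m ^ k) atTop (𝓝 0)) (L : Matrix μ ι ℝ) :
    IsSteadyStationary (fun k ω => L *ᵥ z (m * k) ω) P := by
  have hz := h.memLp hν
  obtain ⟨Y, hY⟩ := h.exists_tendsto_crossMoment hν hF hstab
  have hcross : ∀ i j, i ≤ j → ∃ r, Tendsto
      (fun k => crossMoment P (fun ω => L *ᵥ z (m * (k + j)) ω) (fun ω => L *ᵥ z (m * (k + i)) ω))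
      atTop (𝓝 r) := by
    intro i j hij
    obtain ⟨d, rfl⟩ := Nat.exists_eq_add_of_le hij
    refine ⟨L * (transition F m ^ d * Y) * Lᵀ, ?_⟩
    have hc : Continuous fun M : Matrix ι ι ℝ => L * (transition F m ^ d * M) * Lᵀ := by fun_prop
    refine ((hc.tendsto Y).comp ((tendsto_add_atTop_iff_nat i).2 hY)).congr fun k => ?_
    rw [crossMoment_mulVec_left _ (hz _) (memLp_mulVec _ (hz _)),
      crossMoment_mulVec_right _ (hz _) (hz _), ← add_assoc k i d, h.crossMoment_shift hν hF]
    simp only [Function.comp_apply, Matrix.mul_assoc]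
  refine ⟨h.gaussian hν L _, fun a => ?_, ?_⟩
  · have hc : Continuous fun M : Matrix ι ι ℝ => (L *ᵥ (M *ᵥ z₀)) a := by fun_prop
    have h1 := (hc.tendsto 0).comp hstab
    simp only [Matrix.zero_mulVec, Matrix.mulVec_zero, Pi.zero_apply] at h1
    refine h1.congr fun k => ?_
    rw [integral_mulVec _ fun b => (hz _ b).integrable one_le_two, h.mean hν, transition_period hF]
    rfl
  · have : ∀ i j, ∃ r, Tendsto
        (fun k => crossMoment P (fun ω => L *ᵥ z (m * (k + i)) ω)
          (fun ω => L *ᵥ z (m * (k + j)) ω)) atTop (𝓝 r) := by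
      intro i j
      rcases le_total j i with hij | hij
      · exact hcross j i hij
      · obtain ⟨r, hr⟩ := hcross i j hij
        have hc : Continuous fun M : Matrix μ μ ℝ => Mᵀ := by fun_prop
        exact ⟨rᵀ, ((hc.tendsto r).comp hr).congr fun k => crossMoment_transpose _ _⟩
    choose r hr using this
    exact ⟨r, fun i j a b => tendsto_pi_nhds.1 (tendsto_pi_nhds.1 (hr i j) a) b⟩

end Periodic

end IsResponse

/-! ### Algebra of the clock matrices -/

section Kron

variable {ι κ μ : Type*} [Fintype ι] [Fintype κ] [Fintype μ]

omit [Fintype ι] [Fintype μ] in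
lemma dupl_mul_dupl (M : Matrix ι κ ℝ) (N : Matrix κ μ ℝ) : dupl M * dupl N = dupl (M * N) := by
  rw [dupl, dupl, dupl, ← Matrix.mul_kronecker_mul, one_mul]

omit [Fintype ι] in
lemma dupl_one [DecidableEq ι] : dupl (1 : Matrix ι ι ℝ) = 1 := Matrix.one_kronecker_one

lemma bigA_mul_dupl [DecidableEq ι] [DecidableEq κ] (τ : ℝ) (M : Matrix ι κ ℝ) :
    (bigA τ : Matrix (Fin 2 × ι) (Fin 2 × ι) ℝ) * dupl M =
      dupl M * (bigA τ : Matrix (Fin 2 × κ) (Fin 2 × κ) ℝ) := by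
  rw [dupl, bigA, bigA, ← Matrix.mul_kronecker_mul, ← Matrix.mul_kronecker_mul]
  simp

omit [Fintype κ] in
lemma duplRow_mul_dupl (q : ι → ℝ) (M : Matrix ι κ ℝ) :
    duplRow q * dupl M = duplRow (q ᵥ* M) := by
  ext a ⟨b, j⟩
  fin_cases a <;> fin_cases b <;>
    simp [duplRow, dupl, Matrix.mul_apply, Fintype.sum_prod_type, Matrix.vecMul, dotProduct]

lemma duplRow_mul_bigA [DecidableEq ι] (τ : ℝ) (q : ι → ℝ) :
    duplRow q * (bigA τ : Matrix (Fin 2 × ι) (Fin 2 × ι) ℝ) = clockA τ * duplRow q := by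
  ext a ⟨b, j⟩
  fin_cases a <;> fin_cases b <;>
    simp [duplRow, bigA, clockA, Matrix.mul_apply, Fintype.sum_prod_type, Matrix.one_apply,
      mul_comm]

omit [Fintype ι] in
lemma duplRow_add (q q' : ι → ℝ) : duplRow (q + q') = duplRow q + duplRow q' := by
  ext a p
  simp [duplRow, mul_add]

omit [Fintype ι] in
lemma duplRow_sub (q q' : ι → ℝ) : duplRow (q - q') = duplRow q - duplRow q' := by
  ext a p
  simp [duplRow, mul_sub]

omit [Fintype ι] in
lemma duplRow_zero : duplRow (0 : ι → ℝ) = 0 := by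
  ext a p
  simp [duplRow]

lemma duplRow_mul_duplCol (q e : ι → ℝ) : duplRow q * duplCol e = (q ⬝ᵥ e) • 1 := by
  ext a b
  fin_cases a <;> fin_cases b <;>
    simp [duplRow, duplCol, Matrix.mul_apply, Fintype.sum_prod_type, dotProduct]

omit [Fintype κ] in
lemma dupl_mul_duplCol (M : Matrix κ ι ℝ) (e : ι → ℝ) :
    dupl M * duplCol e = duplCol (M *ᵥ e) := by
  ext ⟨a, i⟩ b
  fin_cases a <;> fin_cases b <;>
    simp [dupl, duplCol, Matrix.mul_apply, Fintype.sum_prod_type, dotProduct, Matrix.mulVec]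

lemma dupl_mul_bigB [DecidableEq ι] [DecidableEq κ] (τ : ℝ) (M : Matrix κ ι ℝ) :
    dupl M * (bigB τ : Matrix (Fin 2 × ι) ι ℝ) = (bigB τ : Matrix (Fin 2 × κ) κ ℝ) * M := by
  ext ⟨a, i⟩ j
  fin_cases a <;>
    simp [dupl, bigB, colKron, Matrix.mul_apply, Fintype.sum_prod_type, Matrix.one_apply, mul_comm]

lemma duplRow_mulVec_bigB [DecidableEq ι] (τ : ℝ) (q u : ι → ℝ) :
    duplRow q *ᵥ (bigB τ *ᵥ u) = (q ⬝ᵥ u) • clockB τ := by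
  ext a
  fin_cases a <;>
    simp [duplRow, bigB, colKron, clockB, Matrix.mulVec, dotProduct, Fintype.sum_prod_type,
      Matrix.one_apply, Finset.mul_sum, mul_comm, mul_left_comm]

omit [Fintype ι] in
lemma dupl_vecMul_duplRow (a : Fin 2 → ℝ) (t : ι → ℝ) :
    a ᵥ* duplRow t = fun p => a p.1 * t p.2 := by
  ext ⟨b, i⟩
  fin_cases b <;> simp [duplRow, Matrix.vecMul, dotProduct]

lemma clockA_pow (τ : ℝ) (k : ℕ) : clockA τ ^ k = !![1, k * τ; 0, 1] := by
  induction k with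
  | zero => simp [Matrix.one_fin_two]
  | succ k ih =>
    rw [pow_succ, ih, clockA]
    ext a b
    fin_cases a <;> fin_cases b <;> simp [Matrix.mul_apply]
    ring

end Kron

namespace Ensemble

variable {n : ℕ} (E : Ensemble n) {q : Fin (n + 1) → ℝ} {W : Matrix (Fin (n + 1)) (Fin n) ℝ}

lemma CN_eq : E.CN = E.Co * dupl E.V := by
  ext i ⟨b, j⟩
  fin_cases b <;>
    simp [CN, Co, rowKron, clockC, dupl, Matrix.mul_apply, Fintype.sum_prod_type, Matrix.one_apply]

/-- By rank-nullity the kernel of V is a line, and it contains 𝟙. -/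
lemma mulVec_V_eq_zero_iff {x : Fin (n + 1) → ℝ} : E.V *ᵥ x = 0 ↔ ∃ c : ℝ, x = c • 1 := by
  constructor
  · intro hx
    have h1 := LinearMap.finrank_range_add_finrank_ker E.V.mulVecLin
    have h2 : Module.finrank ℝ (LinearMap.range E.V.mulVecLin) = n := E.V_rank
    rw [h2, Module.finrank_fin_fun] at h1
    have h3 : Module.finrank ℝ (LinearMap.ker E.V.mulVecLin) = 1 := by omega
    have hone : (1 : Fin (n + 1) → ℝ) ∈ LinearMap.ker E.V.mulVecLin := by
      simpa using E.V_mulVec_one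
    obtain ⟨c, hc⟩ := (finrank_eq_one_iff_of_nonzero' (⟨1, hone⟩ : LinearMap.ker E.V.mulVecLin)
      (by simp [Subtype.ext_iff])).1 h3 ⟨x, by simpa using hx⟩
    exact ⟨c, (congrArg Subtype.val hc).symm⟩
  · rintro ⟨c, rfl⟩
    rw [Matrix.mulVec_smul, E.V_mulVec_one, smul_zero]

lemma eq_zero_of_V_of_q (hq : ∑ i, q i = 1) {x : Fin (n + 1) → ℝ} (hx : E.V *ᵥ x = 0)
    (hx' : q ⬝ᵥ x = 0) : x = 0 := by
  obtain ⟨c, rfl⟩ := E.mulVec_V_eq_zero_iff.1 hx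
  have : c = 0 := by simpa [dotProduct_smul, dotProduct_one, hq] using hx'
  rw [this, zero_smul]

/-- If VWx = 0 then Wx is a multiple of 𝟙; qᵀW = 0 and qᵀ𝟙 = 1 make that multiple zero, and W has
full column rank. -/
lemma isUnit_det_V_mul (hq : ∑ i, q i = 1) (hqW : q ᵥ* W = 0) (hW : W.rank = n) :
    IsUnit (E.V * W).det := by
  rw [← Matrix.isUnit_iff_isUnit_det, ← Matrix.mulVec_injective_iff_isUnit]
  refine (injective_iff_map_eq_zero (E.V * W).mulVecLin).2 fun x hx => ?_
  have h1 : W *ᵥ x = 0 := by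
    refine E.eq_zero_of_V_of_q hq (by simpa using hx) ?_
    rw [Matrix.dotProduct_mulVec, hqW, zero_dotProduct]
  have h2 := LinearMap.finrank_range_add_finrank_ker W.mulVecLin
  have h3 : Module.finrank ℝ (LinearMap.range W.mulVecLin) = n := hW
  rw [h3, Module.finrank_fin_fun] at h2
  have h4 : LinearMap.ker W.mulVecLin = ⊥ := Submodule.finrank_eq_zero.1 (by omega)
  exact LinearMap.ker_eq_bot'.1 h4 x (by simpa using h1)

lemma V_mul_Vplus (hq : ∑ i, q i = 1) (hqW : q ᵥ* W = 0) (hW : W.rank = n) :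
    E.V * E.Vplus W = 1 := by
  rw [Vplus, ← Matrix.mul_assoc, Matrix.mul_nonsing_inv _ (E.isUnit_det_V_mul hq hqW hW)]

lemma vecMul_Vplus (hqW : q ᵥ* W = 0) : q ᵥ* E.Vplus W = 0 := by
  rw [Vplus, ← Matrix.vecMul_vecMul, hqW, Matrix.zero_vecMul]

lemma Vplus_mulVec_add (hq : ∑ i, q i = 1) (hqW : q ᵥ* W = 0) (hW : W.rank = n)
    (x : Fin (n + 1) → ℝ) : E.Vplus W *ᵥ (E.V *ᵥ x) + (q ⬝ᵥ x) • 1 = x := by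
  rw [← sub_eq_zero]
  refine E.eq_zero_of_V_of_q hq ?_ ?_
  · rw [Matrix.mulVec_sub, Matrix.mulVec_add, Matrix.mulVec_mulVec, E.V_mul_Vplus hq hqW hW,
      Matrix.mulVec_smul, E.V_mulVec_one]
    simp
  · rw [dotProduct_sub, dotProduct_add, Matrix.dotProduct_mulVec, E.vecMul_Vplus hqW]
    simp [dotProduct_one, hq]

lemma sum_inv_pos : 0 < ∑ j, (E.σ₂ j ^ 2)⁻¹ :=
  Finset.sum_pos (fun j _ => by have := E.σ₂_pos j; positivity) Finset.univ_nonempty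

lemma sum_qInf : ∑ i, E.qInf i = 1 := by
  simp only [qInf]
  rw [← Finset.sum_div, div_self E.sum_inv_pos.ne']

/-- The row `tᵀ` with `tᵀ V = qᵀ - q_∞ᵀ`. -/
noncomputable def offsetRow (q : Fin (n + 1) → ℝ) (W : Matrix (Fin (n + 1)) (Fin n) ℝ) :
    Fin n → ℝ :=
  (q - E.qInf) ᵥ* E.Vplus W

/-- Both weights sum to one, so q - q_∞ vanishes on 𝟙 and hence factors through V. -/
lemma offsetRow_vecMul (hq : ∑ i, q i = 1) (hqW : q ᵥ* W = 0) (hW : W.rank = n) :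
    E.offsetRow q W ᵥ* E.V = q - E.qInf := by
  refine dotProduct_eq _ _ fun x => ?_
  rw [offsetRow, ← Matrix.dotProduct_mulVec, ← Matrix.dotProduct_mulVec]
  conv_rhs => rw [← E.Vplus_mulVec_add hq hqW hW x]
  rw [dotProduct_add, dotProduct_smul, dotProduct_one]
  simp [hq, E.sum_qInf]

/-! ### Noise covariances -/

lemma Q_quad (x y : Idx n → ℝ) : x ⬝ᵥ E.Q *ᵥ y = ∑ i, (E.τ * E.σ₁ i ^ 2 * (x (0, i) * y (0, i)) +
    E.σ₂ i ^ 2 * (E.τ ^ 3 / 3 * (x (0, i) * y (0, i)) +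
      E.τ ^ 2 / 2 * (x (0, i) * y (1, i) + x (1, i) * y (0, i)) +
        E.τ * (x (1, i) * y (1, i)))) := by
  simp only [Q, dotProduct, Matrix.mulVec, Fintype.sum_prod_type, Fin.sum_univ_two,
    Matrix.add_apply, Matrix.kroneckerMap_apply, Matrix.diagonal_apply, mul_ite, mul_zero,
    ite_mul, zero_mul, add_mul, Finset.sum_add_distrib, Finset.sum_ite_eq, Finset.mem_univ, if_true]
  simp only [← Finset.sum_add_distrib]
  refine Finset.sum_congr rfl fun i _ => ?_
  simp
  ring

lemma Q_posDef : E.Q.PosDef := by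
  refine .of_dotProduct_mulVec_pos ?_ fun {x} hx => ?_
  · refine Matrix.IsHermitian.ext ?_
    rintro ⟨a, i⟩ ⟨b, j⟩
    by_cases hij : i = j
    · subst hij
      fin_cases a <;> fin_cases b <;> simp [Q]
    · simp [Q, hij, Ne.symm hij]
  · rw [star_trivial, Q_quad]
    have hτ := E.τ_pos
    -- Completing the square in the frequency coordinate; the remainder τ³/12 = τ³/3 - τ³/4 keeps
    -- the random walk part definite, so σ₁ may vanish.
    have key : ∀ i, E.τ * E.σ₁ i ^ 2 * (x (0, i) * x (0, i)) +
        E.σ₂ i ^ 2 * (E.τ ^ 3 / 3 * (x (0, i) * x (0, i)) +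
          E.τ ^ 2 / 2 * (x (0, i) * x (1, i) + x (1, i) * x (0, i)) +
            E.τ * (x (1, i) * x (1, i))) = E.τ * E.σ₁ i ^ 2 * x (0, i) ^ 2 +
        E.σ₂ i ^ 2 * E.τ * ((x (1, i) + E.τ / 2 * x (0, i)) ^ 2 + E.τ ^ 2 / 12 * x (0, i) ^ 2) :=
      fun i => by ring
    simp_rw [key]
    obtain ⟨⟨a, i⟩, hai⟩ := Function.ne_iff.1 hx
    refine Finset.sum_pos' (fun i _ => by positivity) ⟨i, Finset.mem_univ _, ?_⟩
    have hσ := E.σ₂_pos i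
    by_cases h0 : x (0, i) = 0
    · have h1 : x (1, i) ≠ 0 := by
        fin_cases a
        · exact absurd h0 hai
        · exact hai
      rw [h0]
      have : 0 < x (1, i) ^ 2 := by positivity
      simp only [mul_zero, add_zero, ne_eq, OfNat.ofNat_ne_zero, not_false_eq_true, zero_pow,
        zero_add]
      positivity
    · have : 0 < x (0, i) ^ 2 := by positivity
      positivity

/-- The covariance of the noise acting on the observable state. -/
noncomputable def obsCov : Matrix (ObsIdx n) (ObsIdx n) ℝ := dupl E.V * E.Q * (dupl E.V)ᵀ

lemma vecMul_dupl_V_injective (hq : ∑ i, q i = 1) (hqW : q ᵥ* W = 0) (hW : W.rank = n) :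
    Function.Injective fun y => y ᵥ* dupl E.V := by
  refine (injective_iff_map_eq_zero (dupl E.V).vecMulLinear).2 fun y hy => ?_
  have h1 : (y ᵥ* dupl E.V) ᵥ* dupl (E.Vplus W) = 0 := by
    rw [show y ᵥ* dupl E.V = 0 from hy, Matrix.zero_vecMul]
  rwa [Matrix.vecMul_vecMul, dupl_mul_dupl, E.V_mul_Vplus hq hqW hW, dupl_one,
    Matrix.vecMul_one] at h1

lemma obsCov_posDef (hq : ∑ i, q i = 1) (hqW : q ᵥ* W = 0) (hW : W.rank = n) :
    E.obsCov.PosDef := by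
  simpa [obsCov] using E.Q_posDef.mul_mul_conjTranspose_same (B := dupl E.V)
    (E.vecMul_dupl_V_injective hq hqW hW)

end Ensemble

namespace Ensemble

/-! ### The stationary Kalman gains -/

variable {n : ℕ} (E : Ensemble n) {q : Fin (n + 1) → ℝ} {W : Matrix (Fin (n + 1)) (Fin n) ℝ}

/-- A deadbeat observer gain for the observable state. -/
noncomputable def deadbeat : Matrix (ObsIdx n) (Fin n) ℝ := colKron ![1, E.τ⁻¹] 1

/-- The gain (1, 1/τ) places both eigenvalues of the single-clock error matrix at zero, so the error
dies in two steps. This supplies the nilpotent gain in `riccati_tendsto`. -/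
lemma deadbeat_mul_self :
    E.Ao * (1 - E.deadbeat * E.Co) * (E.Ao * (1 - E.deadbeat * E.Co)) = 0 := by
  have hτ := E.τ_pos.ne'
  have h1 : 1 - E.deadbeat * E.Co = !![0, 0; -E.τ⁻¹, 1] ⊗ₖ (1 : Matrix (Fin n) (Fin n) ℝ) := by
    ext ⟨a, i⟩ ⟨b, j⟩
    by_cases hij : i = j
    · subst hij
      fin_cases a <;> fin_cases b <;>
        simp [deadbeat, Co, colKron, rowKron, clockC, Matrix.mul_apply, Matrix.one_apply]
    · fin_cases a <;> fin_cases b <;>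
        simp [deadbeat, Co, colKron, rowKron, clockC, Matrix.mul_apply, Matrix.one_apply, hij]
  have h2 : E.Ao * (1 - E.deadbeat * E.Co) =
      !![-1, E.τ; -E.τ⁻¹, 1] ⊗ₖ (1 : Matrix (Fin n) (Fin n) ℝ) := by
    rw [h1, Ao, bigA, ← Matrix.mul_kronecker_mul, clockA, Matrix.mul_one]
    congr 1
    ext a b
    fin_cases a <;> fin_cases b <;> simp [Matrix.mul_apply, hτ]
  rw [h2, ← Matrix.mul_kronecker_mul]
  have h3 : !![-1, E.τ; -E.τ⁻¹, 1] * !![-1, E.τ; -E.τ⁻¹, 1] = 0 := by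
    ext a b
    fin_cases a <;> fin_cases b <;> simp [Matrix.mul_apply, hτ]
  rw [h3, Matrix.zero_kronecker]

/-- The row `q_∞ᵀ Σ₁ Vᵀ`. -/
noncomputable def biasRow : Fin n → ℝ := E.V *ᵥ fun i => E.σ₁ i ^ 2 * E.qInf i

/-- The difference between the stationary values of `P_ōo⁻` and `(I₂ ⊗ tᵀ) P_oo⁻`. -/
noncomputable def crossBias : Matrix (Fin 2) (ObsIdx n) ℝ :=
  Matrix.of fun a p => if a = 0 ∧ p.1 = 1 then -E.biasRow p.2 else 0

/-- The Σ₂ part carries the factor q_∞ᵀΣ₂Vᵀ, which is proportional to (V𝟙)ᵀ = 0. Only white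
frequency noise survives, in the phase-phase block. -/
lemma qInf_noise_cov : duplRow E.qInf * E.Q * (dupl E.V)ᵀ =
    Matrix.of fun a p => if a = 0 ∧ p.1 = 0 then E.τ * E.biasRow p.2 else 0 := by
  have h0 : ∀ k, ∑ i, E.V k i = 0 := fun k => by
    have := congrFun E.V_mulVec_one k
    simpa [Matrix.mulVec, dotProduct] using this
  have h1 : ∀ k, ∑ i, E.qInf i * E.σ₂ i ^ 2 * E.V k i = 0 := by
    intro k
    have : ∀ i, E.qInf i * E.σ₂ i ^ 2 * E.V k i = (∑ j, (E.σ₂ j ^ 2)⁻¹)⁻¹ * E.V k i := by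
      intro i
      have h2 := (E.σ₂_pos i).ne'
      rw [qInf]
      field_simp
    simp_rw [this, ← Finset.mul_sum, h0, mul_zero]
  have key : ∀ (a b : Fin 2) (k : Fin n), (duplRow E.qInf * E.Q * (dupl E.V)ᵀ) a (b, k) =
      !![E.τ, 0; 0, 0] a b * E.biasRow k + !![E.τ ^ 3 / 3, E.τ ^ 2 / 2; E.τ ^ 2 / 2, E.τ] a b *
        ∑ i, E.qInf i * E.σ₂ i ^ 2 * E.V k i := by
    intro a b k
    simp only [biasRow, Matrix.mulVec, dotProduct, Finset.mul_sum, ← Finset.sum_add_distrib]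
    simp only [duplRow, dupl, Q, Matrix.mul_apply, Fintype.sum_prod_type, Fin.sum_univ_two,
      Matrix.of_apply, Matrix.add_apply, Matrix.kroneckerMap_apply, Matrix.diagonal_apply,
      Matrix.transpose_apply, Matrix.one_apply, mul_add, mul_ite, mul_zero, Finset.sum_add_distrib,
      Finset.sum_ite_eq', Finset.mem_univ, if_true]
    simp only [← Finset.sum_add_distrib]
    refine Finset.sum_congr rfl fun i _ => ?_
    fin_cases a <;> fin_cases b <;> simp <;> ring
  ext a ⟨b, k⟩
  rw [key, h1]
  fin_cases a <;> fin_cases b <;> simp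

/-- The bias sits in the frequency columns, while the output reads phases. It therefore affects the
covariance but not the gain. -/
lemma crossBias_mul_Co : E.crossBias * E.Coᵀ = 0 := by
  ext a j
  fin_cases a <;>
    simp [crossBias, Co, rowKron, clockC, Matrix.mul_apply, Fintype.sum_prod_type]

/-- Multiplication by `E.Aoᵀ` copies τ times the frequency columns into the phase columns, where
they cancel the noise covariance of `qInf_noise_cov`. -/
lemma crossBias_eq : clockA E.τ * E.crossBias * E.Aoᵀ + duplRow E.qInf * E.Q * (dupl E.V)ᵀ =
    E.crossBias := by
  rw [qInf_noise_cov]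
  ext a ⟨b, k⟩
  simp only [crossBias, Ao, bigA, Matrix.add_apply, Matrix.mul_apply, Fintype.sum_prod_type,
    Fin.sum_univ_two, Matrix.transpose_apply, Matrix.kroneckerMap_apply, Matrix.of_apply,
    Matrix.one_apply]
  fin_cases a <;> fin_cases b <;> simp [clockA, mul_comm]

lemma prior_fst_succ (P₀ : Matrix (ObsIdx n) (ObsIdx n) ℝ × Matrix (Fin 2) (ObsIdx n) ℝ) (k : ℕ) :
    (E.prior q W P₀ (k + 1)).1 = riccati E.Ao E.Co E.R E.obsCov (E.prior q W P₀ k).1 := rfl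

variable (hq : ∑ i, q i = 1) (hqW : q ᵥ* W = 0) (hW : W.rank = n)
include hq hqW hW

lemma duplRow_noise_cov : duplRow q * E.Q * (dupl E.V)ᵀ =
    duplRow (E.offsetRow q W) * E.obsCov + duplRow E.qInf * E.Q * (dupl E.V)ᵀ := by
  have h : duplRow q = duplRow (E.offsetRow q W) * dupl E.V + duplRow E.qInf := by
    rw [duplRow_mul_dupl, E.offsetRow_vecMul hq hqW hW, ← duplRow_add, sub_add_cancel]
  rw [h, obsCov]
  simp only [Matrix.add_mul, Matrix.mul_assoc]

variable {P₀ : Matrix (ObsIdx n) (ObsIdx n) ℝ × Matrix (Fin 2) (ObsIdx n) ℝ}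
  (hP₀ : P₀.1.PosSemidef)
include hP₀

lemma prior_posSemidef (k : ℕ) : (E.prior q W P₀ k).1.PosSemidef := by
  induction k with
  | zero => exact hP₀
  | succ k ih =>
    rw [prior_fst_succ]
    exact riccati_posSemidef E.R_posDef (E.obsCov_posDef hq hqW hW).posSemidef ih

/-- The deviation of `P_ōo⁻` from `(I₂ ⊗ tᵀ) P_oo⁻ + crossBias` obeys a homogeneous recursion. -/
lemma prior_snd_succ (k : ℕ) :
    (E.prior q W P₀ (k + 1)).2 - duplRow (E.offsetRow q W) * (E.prior q W P₀ (k + 1)).1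
      - E.crossBias = clockA E.τ * ((E.prior q W P₀ k).2 -
        duplRow (E.offsetRow q W) * (E.prior q W P₀ k).1 - E.crossBias) *
        (E.Ao * (1 - kalmanGain E.Co E.R (E.prior q W P₀ k).1 * E.Co))ᵀ := by
  set X := E.prior q W P₀ k with hX
  set H := kalmanGain E.Co E.R X.1 with hH
  set t := duplRow (E.offsetRow q W)
  have hpost : (1 - H * E.Co) * X.1 = X.1 * (1 - E.Coᵀ * Hᵀ) :=
    posterior_eq_mul E.R_posDef (E.prior_posSemidef hq hqW hW hP₀ k)
  have h1 : (E.prior q W P₀ (k + 1)).2 = (duplRow q * E.AN * dupl (E.Vplus W) *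
      ((1 - H * E.Co) * X.1) + clockA E.τ * (X.2 * (1 - E.Coᵀ * Hᵀ))) * E.Aoᵀ +
        duplRow q * E.Q * (dupl E.V)ᵀ := rfl
  -- The coupling from the observable to the unobservable state vanishes: qᵀ passes through A and
  -- meets qᵀV⁺ = 0.
  have h2 : duplRow q * E.AN * dupl (E.Vplus W) = 0 := by
    rw [AN, duplRow_mul_bigA, Matrix.mul_assoc, duplRow_mul_dupl, E.vecMul_Vplus hqW, duplRow_zero,
      Matrix.mul_zero]
  have h3 : t * E.Ao = clockA E.τ * t := duplRow_mul_bigA _ _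
  have h4 : t * (E.prior q W P₀ (k + 1)).1 =
      clockA E.τ * t * (X.1 * (1 - E.Coᵀ * Hᵀ)) * E.Aoᵀ + t * E.obsCov := by
    rw [prior_fst_succ, riccati, ← hX, ← hH, hpost, Matrix.mul_add, ← Matrix.mul_assoc,
      ← Matrix.mul_assoc, h3]
  have h5 : E.crossBias * (1 - E.Coᵀ * Hᵀ) = E.crossBias := by
    rw [Matrix.mul_sub, Matrix.mul_one, ← Matrix.mul_assoc, E.crossBias_mul_Co, Matrix.zero_mul,
      sub_zero]
  have h6 := E.crossBias_eq
  have h7 : (E.Ao * (1 - H * E.Co))ᵀ = (1 - E.Coᵀ * Hᵀ) * E.Aoᵀ := by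
    simp [Matrix.transpose_mul]
  have h8 : clockA E.τ * E.crossBias * ((1 - E.Coᵀ * Hᵀ) * E.Aoᵀ) =
      E.crossBias - duplRow E.qInf * E.Q * (dupl E.V)ᵀ := by
    rw [← Matrix.mul_assoc, Matrix.mul_assoc (clockA E.τ), h5, eq_sub_iff_add_eq, h6]
  have h9 (M : Matrix (ObsIdx n) (ObsIdx n) ℝ) : clockA E.τ * (X.2 - t * X.1 - E.crossBias) * M =
      clockA E.τ * X.2 * M - clockA E.τ * (t * X.1) * M - clockA E.τ * E.crossBias * M := by
    simp only [Matrix.mul_sub, Matrix.sub_mul]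
  rw [h1, h2, h4, h7, E.duplRow_noise_cov hq hqW hW, h9, h8]
  simp only [Matrix.zero_mul, zero_add, Matrix.mul_assoc]
  abel

lemma tendsto_prior {Ps : Matrix (ObsIdx n) (ObsIdx n) ℝ}
    (hPs : Tendsto (fun k => (E.prior q W P₀ k).1) atTop (𝓝 Ps)) :
    Tendsto (fun k => (E.prior q W P₀ k).2) atTop
      (𝓝 (duplRow (E.offsetRow q W) * Ps + E.crossBias)) := by
  set D : ℕ → Matrix (Fin 2) (ObsIdx n) ℝ := fun k => (E.prior q W P₀ k).2 -
    duplRow (E.offsetRow q W) * (E.prior q W P₀ k).1 - E.crossBias with hD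
  -- Time is shifted by one because `P₀.1` is only semidefinite, whereas after one step the
  -- covariance dominates `obsCov`, as the Lyapunov argument needs.
  let F : ℕ → Matrix (ObsIdx n) (ObsIdx n) ℝ := fun k =>
    E.Ao * (1 - kalmanGain E.Co E.R (E.prior q W P₀ (k + 1)).1 * E.Co)
  have hpsd := E.prior_posSemidef hq hqW hW hP₀
  have hDk : ∀ k, D (k + 1) = clockA E.τ ^ k * (D 1 * (transition F k)ᵀ) := by
    intro k
    induction k with
    | zero => simp [transition]
    | succ k ih =>
      have h1 : D (k + 1 + 1) = clockA E.τ * D (k + 1) * (F k)ᵀ :=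
        E.prior_snd_succ hq hqW hW hP₀ (k + 1)
      rw [h1, ih, transition, Matrix.transpose_mul (F k) (transition F k), pow_succ']
      simp only [Matrix.mul_assoc]
  have hPs1 := (tendsto_add_atTop_iff_nat 1).2 hPs
  obtain ⟨p, hp⟩ := exists_quad_le_of_tendsto hPs1
  obtain ⟨b, r, hr0, hr1, hb⟩ := exists_geometric_decay (E.obsCov_posDef hq hqW hW)
    (P := fun k => (E.prior q W P₀ (k + 1)).1) (A := F) (M := transition F)
    (fun k => riccati_sub_posSemidef E.R_posDef (hpsd k)) hp
    (fun k => riccati_step_posSemidef E.R_posDef (hpsd (k + 1))) rfl (fun _ => rfl)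
  have hM : Tendsto (transition F) atTop (𝓝 0) := tendsto_zero_of_geometric hr0 hr1 hb
  -- The left factor A^k grows only linearly, so it cannot offset the geometric decay of the right
  -- factor.
  have hkM : Tendsto (fun k : ℕ => (k : ℝ) • transition F k) atTop (𝓝 0) := by
    refine tendsto_pi_nhds.2 fun i => tendsto_pi_nhds.2 fun j => ?_
    have h1 := (tendsto_self_mul_const_pow_of_lt_one hr0 hr1).const_mul b
    rw [mul_zero] at h1
    refine squeeze_zero_norm (fun k => ?_) h1
    rw [Matrix.smul_apply, norm_smul, Real.norm_natCast, Real.norm_eq_abs]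
    calc _ ≤ (k : ℝ) * (b * r ^ k) := by gcongr; exact hb k i j
      _ = _ := by ring
  have hApow : ∀ k : ℕ, clockA E.τ ^ k = 1 + (k : ℝ) • !![0, E.τ; 0, 0] := by
    intro k
    rw [clockA_pow, Matrix.one_fin_two]
    ext a b
    fin_cases a <;> fin_cases b <;> simp
  have hD0 : Tendsto (fun k => D (k + 1)) atTop (𝓝 0) := by
    have h1 : ∀ k, D (k + 1) = D 1 * (transition F k)ᵀ +
        !![0, E.τ; 0, 0] * (D 1 * ((k : ℝ) • transition F k)ᵀ) := by
      intro k
      rw [hDk, hApow, Matrix.add_mul, Matrix.one_mul, Matrix.smul_mul, Matrix.transpose_smul,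
        Matrix.mul_smul, Matrix.mul_smul]
    rw [funext h1]
    have hc1 : Continuous fun M : Matrix (ObsIdx n) (ObsIdx n) ℝ => D 1 * Mᵀ := by fun_prop
    have hc2 : Continuous fun M : Matrix (ObsIdx n) (ObsIdx n) ℝ =>
      !![0, E.τ; 0, 0] * (D 1 * Mᵀ) := by fun_prop
    have h2 := ((hc1.tendsto 0).comp hM).add ((hc2.tendsto 0).comp hkM)
    simp only [Function.comp_def, Matrix.transpose_zero, Matrix.mul_zero, add_zero] at h2
    exact h2
  have hD1 : Tendsto D atTop (𝓝 0) := (tendsto_add_atTop_iff_nat 1).1 hD0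
  have hc : Continuous fun M : Matrix (ObsIdx n) (ObsIdx n) ℝ =>
    duplRow (E.offsetRow q W) * M + E.crossBias := by fun_prop
  have h2 := hD1.add ((hc.tendsto Ps).comp hPs)
  rw [zero_add] at h2
  refine h2.congr fun k => ?_
  simp only [hD, Function.comp_apply]
  abel

/-- The stationary Kalman gains come from a fixed point of the Riccati recursion, and
`H_ō⋆ = (I₂ ⊗ tᵀ) H_o⋆`. -/
theorem exists_stationaryGain_eq : ∃ Ps, Ps.PosSemidef ∧
    riccati E.Ao E.Co E.R E.obsCov Ps = Ps ∧
    E.stationaryGain q W P₀ = (kalmanGain E.Co E.R Ps,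
      duplRow (E.offsetRow q W) * kalmanGain E.Co E.R Ps) := by
  obtain ⟨Ps, hPs, hfix, hconv⟩ := riccati_tendsto E.R_posDef (E.obsCov_posDef hq hqW hW)
    E.deadbeat_mul_self
  refine ⟨Ps, hPs, hfix, ?_⟩
  have h1 : Tendsto (fun k => (E.prior q W P₀ k).1) atTop (𝓝 Ps) := hconv _ hP₀ fun k => rfl
  have h2 := E.tendsto_prior hq hqW hW hP₀ h1
  have hinv := (continuousAt_kalmanGain (C := E.Co) E.R_posDef hPs).tendsto.comp h1
  have hmul {ι : Type} : Continuous fun p : Matrix ι (ObsIdx n) ℝ × Matrix (Fin n) (Fin n) ℝ =>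
      p.1 * E.Coᵀ * p.2 := by fun_prop
  have h3 := (hmul.tendsto (Ps, _)).comp (h1.prodMk_nhds hinv)
  have h4 := (hmul.tendsto (duplRow (E.offsetRow q W) * Ps + E.crossBias, _)).comp
    (h2.prodMk_nhds hinv)
  have h5 := (h3.prodMk_nhds h4).limUnder_eq
  refine Eq.trans h5 ?_
  simp only [kalmanGain, Matrix.add_mul, E.crossBias_mul_Co, add_zero, Matrix.mul_assoc]

omit hP₀ in
/-- Nondegeneracy of the stationary gain in the directions `a ⊗ t` with `a 0 * a 1 ≥ 0`. -/
lemma vecMul_gain_ne_zero {Ps : Matrix (ObsIdx n) (ObsIdx n) ℝ} (hPs : Ps.PosSemidef)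
    (hfix : riccati E.Ao E.Co E.R E.obsCov Ps = Ps) (hne : q ≠ E.qInf) {a : Fin 2 → ℝ}
    (ha : 0 ≤ a 0 * a 1) (ha1 : a 1 ≠ 0) :
    a ᵥ* (duplRow (E.offsetRow q W) * kalmanGain E.Co E.R Ps) ≠ 0 := by
  intro h0
  set t := E.offsetRow q W
  set H := kalmanGain E.Co E.R Ps
  set Post := (1 - H * E.Co) * Ps with hPost
  have hpost : Post.PosSemidef := posterior_posSemidef E.R_posDef hPs
  have hric : E.Ao * Post * E.Aoᵀ + E.obsCov = Ps := hfix
  have hgain : Ps = Post + H * (E.Co * Ps) := by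
    rw [hPost, Matrix.sub_mul, Matrix.one_mul, Matrix.mul_assoc, sub_add_cancel]
  clear_value Post
  rw [← Matrix.vecMul_vecMul, dupl_vecMul_duplRow] at h0
  set y : ObsIdx n → ℝ := fun p => a p.1 * t p.2 with hy
  -- The test vector u is fixed by `E.Aoᵀ`, and `E.Aoᵀ` moves y only along u. If yᵀH = 0,
  -- measurement does not change the pairing of y with u, so the stationary equation must balance
  -- the gain in prediction alone.
  let u : ObsIdx n → ℝ := fun p => ![0, 1] p.1 * t p.2
  have h1 : y ⬝ᵥ Ps *ᵥ u = y ⬝ᵥ Post *ᵥ u := by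
    conv_lhs => rw [hgain]
    rw [Matrix.add_mulVec, dotProduct_add, ← Matrix.mulVec_mulVec, Matrix.dotProduct_mulVec y H,
      h0, zero_dotProduct, add_zero]
  have hAu : E.Aoᵀ *ᵥ u = u := by
    ext ⟨b, i⟩
    fin_cases b <;> simp [u, Ao, bigA, clockA, Matrix.mulVec, dotProduct, Fintype.sum_prod_type,
      Matrix.one_apply]
  have hAy : E.Aoᵀ *ᵥ y = y + (E.τ * a 0) • u := by
    ext ⟨b, i⟩
    fin_cases b
    · simp [u, y, Ao, bigA, clockA, Matrix.mulVec, dotProduct, Fintype.sum_prod_type,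
        Matrix.one_apply]
    · simp [u, y, Ao, bigA, clockA, Matrix.mulVec, dotProduct, Fintype.sum_prod_type,
        Matrix.one_apply]
      ring
  have h2 : y ⬝ᵥ Ps *ᵥ u = (y + (E.τ * a 0) • u) ⬝ᵥ Post *ᵥ u + y ⬝ᵥ E.obsCov *ᵥ u := by
    conv_lhs => rw [← hric]
    rw [Matrix.add_mulVec, dotProduct_add, ← Matrix.mulVec_mulVec, hAu,
      ← Matrix.mulVec_mulVec, Matrix.dotProduct_mulVec y E.Ao, ← Matrix.mulVec_transpose, hAy]
  set d := q - E.qInf with hd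
  have hVd : ∀ b : Fin 2 → ℝ, (dupl E.V)ᵀ *ᵥ (fun p : ObsIdx n => b p.1 * t p.2) =
      fun p => b p.1 * d p.2 := by
    intro b
    rw [Matrix.mulVec_transpose, ← dupl_vecMul_duplRow, Matrix.vecMul_vecMul, duplRow_mul_dupl,
      E.offsetRow_vecMul hq hqW hW, dupl_vecMul_duplRow]
  have h3 : y ⬝ᵥ E.obsCov *ᵥ u =
      (a 0 * (E.τ ^ 2 / 2) + a 1 * E.τ) * ∑ i, E.σ₂ i ^ 2 * d i ^ 2 := by
    rw [obsCov, ← Matrix.mulVec_mulVec, hVd, ← Matrix.mulVec_mulVec,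
      Matrix.dotProduct_mulVec y (dupl E.V), ← Matrix.mulVec_transpose, hVd, Q_quad,
      Finset.mul_sum]
    refine Finset.sum_congr rfl fun i _ => ?_
    simp
    ring
  have h4 : 0 < ∑ i, E.σ₂ i ^ 2 * d i ^ 2 := by
    obtain ⟨i, hi⟩ := Function.ne_iff.1 hne
    have hdi : d i ≠ 0 := sub_ne_zero.2 hi
    have := E.σ₂_pos i
    exact Finset.sum_pos' (fun i _ => by positivity) ⟨i, Finset.mem_univ _, by positivity⟩
  have h5 := posSemidef_quad_nonneg hpost u
  rw [h1, h3, add_dotProduct, smul_dotProduct, smul_eq_mul] at h2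
  have hτ := E.τ_pos
  -- Multiplying the balance by a₁ makes all terms nonnegative; a₁²τ Σᵢ σ₂ᵢ²dᵢ² is strictly positive
  -- because q ≠ q_∞.
  have h6 : 0 = (a 0 * a 1) * E.τ * (u ⬝ᵥ Post *ᵥ u) + ((a 0 * a 1) * (E.τ ^ 2 / 2) +
      a 1 ^ 2 * E.τ) * ∑ i, E.σ₂ i ^ 2 * d i ^ 2 := by
    linear_combination (a 1) * h2
  have h7 : 0 < (a 0 * a 1) * E.τ * (u ⬝ᵥ Post *ᵥ u) + ((a 0 * a 1) * (E.τ ^ 2 / 2) +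
      a 1 ^ 2 * E.τ) * ∑ i, E.σ₂ i ^ 2 * d i ^ 2 := by
    positivity
  exact h7.ne h6

end Ensemble

/-! ### More on transition matrices and moments -/

section Transition

variable {ι κ : Type*} [Fintype ι] [DecidableEq ι] [Fintype κ] [DecidableEq κ]

lemma IsSchur.pow {M : Matrix ι ι ℝ} (h : IsSchur M) {m : ℕ} (hm : m ≠ 0) : IsSchur (M ^ m) := by
  refine isSchur_of_tendsto_pow ?_
  simp_rw [← pow_mul]
  exact h.tendsto_pow.comp (tendsto_id.const_mul_atTop' (Nat.pos_of_ne_zero hm))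

lemma transition_const (M : Matrix ι ι ℝ) (k : ℕ) : transition (fun _ => M) k = M ^ k := by
  induction k with
  | zero => rfl
  | succ k ih => rw [transition, ih, pow_succ']

lemma transition_fromBlocks (M₁ : ℕ → Matrix ι ι ℝ) (X : ℕ → Matrix κ ι ℝ)
    (M₂ : ℕ → Matrix κ κ ℝ) (k : ℕ) :
    ∃ Y, transition (fun k => Matrix.fromBlocks (M₁ k) 0 (X k) (M₂ k)) k =
      Matrix.fromBlocks (transition M₁ k) 0 Y (transition M₂ k) := by
  induction k with
  | zero => exact ⟨0, by simp [transition, Matrix.fromBlocks_one]⟩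
  | succ k ih =>
    obtain ⟨Y, hY⟩ := ih
    exact ⟨_, by rw [transition, hY, Matrix.fromBlocks_multiply]; simp [transition]; rfl⟩

omit [DecidableEq ι] [DecidableEq κ] in
lemma posDef_fromBlocks_diag {Q : Matrix ι ι ℝ} {R : Matrix κ κ ℝ} (hQ : Q.PosDef)
    (hR : R.PosDef) : (Matrix.fromBlocks Q 0 0 R).PosDef := by
  refine .of_dotProduct_mulVec_pos (hQ.1.fromBlocks (by simp) hR.1) fun {x} hx => ?_
  rw [star_trivial, ← Sum.elim_comp_inl_inr x, Matrix.fromBlocks_mulVec, sumElim_dotProduct_sumElim]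
  simp only [Sum.elim_comp_inl, Sum.elim_comp_inr, Matrix.zero_mulVec, add_zero, zero_add]
  by_cases h0 : x ∘ Sum.inl = 0
  · have h1 : x ∘ Sum.inr ≠ 0 := fun h1 => hx <| by
      rw [← Sum.elim_comp_inl_inr x, h0, h1]
      ext (i | i) <;> rfl
    exact add_pos_of_nonneg_of_pos (posSemidef_quad_nonneg hQ.posSemidef _) (posDef_quad_pos hR h1)
  · exact add_pos_of_pos_of_nonneg (posDef_quad_pos hQ h0) (posSemidef_quad_nonneg hR.posSemidef _)

omit [DecidableEq ι] in
lemma accumulatedCov_posSemidef (F : ℕ → Matrix ι ι ℝ) {D : Matrix ι ι ℝ} (hD : D.PosSemidef)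
    (k : ℕ) : (accumulatedCov F D k).PosSemidef := by
  induction k with
  | zero => exact .zero
  | succ k ih => exact (posSemidef_conj ih _).add hD

omit [DecidableEq ι] [DecidableEq κ] in
lemma vecMul_eq_zero_of_quad {S : Matrix κ κ ℝ} (hS : S.PosDef) {B : Matrix ι κ ℝ} {x : ι → ℝ}
    (h : x ⬝ᵥ (B * S * Bᵀ) *ᵥ x = 0) : x ᵥ* B = 0 := by
  by_contra hne
  rw [quad_conj, Matrix.mulVec_transpose] at h
  exact (posDef_quad_pos hS hne).ne' h

end Transition

section Moments

variable {Ω : Type*} [MeasurableSpace Ω] {P : Measure Ω}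

lemma memLp_of_isGaussianProcess {ι : Type*} [Fintype ι] {X : ℕ → Ω → ι → ℝ}
    (h : IsGaussianProcess X P) (k : ℕ) (a : ι) : MemLp (fun ω => X k ω a) 2 P :=
  ((h.hasGaussianLaw_eval k).map_fun (ContinuousLinearMap.proj a)).memLp_two

lemma quad_crossMoment {ι : Type*} [Fintype ι] {X : Ω → ι → ℝ}
    (hX : ∀ a, MemLp (fun ω => X ω a) 2 P) (x : ι → ℝ) :
    x ⬝ᵥ crossMoment P X X *ᵥ x = ∫ ω, (x ⬝ᵥ X ω) ^ 2 ∂P := by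
  have h1 := crossMoment_mulVec_left (P := P) (Matrix.replicateRow Unit x) hX
    (memLp_mulVec (Matrix.replicateRow Unit x) hX)
  rw [crossMoment_mulVec_right _ hX hX] at h1
  have h2 := congrFun (congrFun h1 ()) ()
  simp only [crossMoment, Matrix.of_apply] at h2
  calc _ = (Matrix.replicateRow Unit x * (crossMoment P X X *
        (Matrix.replicateRow Unit x)ᵀ)) () () := rfl
    _ = ∫ ω, (x ⬝ᵥ X ω) * (x ⬝ᵥ X ω) ∂P := h2.symm
    _ = _ := by simp_rw [sq]

/-- Along a left fixed vector of the period matrix nothing is forgotten: each period adds the same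
amount α to the second moment, and boundedness forces α = 0. -/
lemma IsResponse.quad_accumulatedCov_eq_zero [IsProbabilityMeasure P] {ι κ : Type*} [Fintype ι]
    [DecidableEq ι] [Fintype κ] {F : ℕ → Matrix ι ι ℝ} {B : Matrix ι κ ℝ} {ν : ℕ → Ω → κ → ℝ}
    {S : Matrix κ κ ℝ} {z₀ : ι → ℝ} {z : ℕ → Ω → ι → ℝ} {m : ℕ} (h : IsResponse F B ν z₀ z)
    (hν : IsWhiteGaussian ν S P) (hS : S.PosSemidef) (hF : ∀ k j, F (m * k + j) = F j)
    {x : ι → ℝ} (hx : x ᵥ* transition F m = x) {b : ℝ}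
    (hb : ∀ k, ∫ ω, (x ⬝ᵥ z (m * k) ω) ^ 2 ∂P ≤ b) :
    x ⬝ᵥ accumulatedCov F (B * S * Bᵀ) m *ᵥ x = 0 := by
  set α := x ⬝ᵥ accumulatedCov F (B * S * Bᵀ) m *ᵥ x with hα
  have hα0 : 0 ≤ α :=
    posSemidef_quad_nonneg (accumulatedCov_posSemidef F (posSemidef_conj hS B) m) x
  have h1 : ∀ k : ℕ, k * α ≤ ∫ ω, (x ⬝ᵥ z (m * k) ω) ^ 2 ∂P := by
    intro k
    induction k with
    | zero => simpa using integral_nonneg fun ω => sq_nonneg _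
    | succ k ih =>
      rw [← quad_crossMoment (h.memLp hν _)] at ih ⊢
      rw [h.crossMoment_period hν hF, Matrix.add_mulVec, dotProduct_add, quad_conj,
        Matrix.mulVec_transpose, hx, ← hα]
      push_cast
      linarith
  by_contra hne
  have hpos : 0 < α := lt_of_le_of_ne hα0 (Ne.symm hne)
  obtain ⟨k, hk⟩ := exists_nat_gt (b / α)
  rw [div_lt_iff₀ hpos] at hk
  linarith [h1 k, hb k]

end Moments

/-! ### Closed loop coordinates -/

lemma Controller.Fb_period {n : ℕ} (c : Controller n) (k j : ℕ) : c.Fb (c.m * k + j) = c.Fb j := by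
  simp [Controller.Fb, Nat.dvd_add_right]

namespace Ensemble

variable {n : ℕ} (E : Ensemble n) {q : Fin (n + 1) → ℝ} {W : Matrix (Fin (n + 1)) (Fin n) ℝ}
  (c : Controller n) (H : Matrix (ObsIdx n) (Fin n) ℝ) (t : Fin n → ℝ)

/-- The estimation error of the observable state. -/
def obsErr (s : LoopState n) : ObsIdx n → ℝ := dupl E.V *ᵥ s.x - s.ξo

/-- The part of the estimation error of the ensemble mean that is not driven by noise. -/
def meanErr (q : Fin (n + 1) → ℝ) (s : LoopState n) (r : Fin 2 → ℝ) : Fin 2 → ℝ :=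
  duplRow q *ᵥ s.x - r - s.ξb - duplRow t *ᵥ E.obsErr s

/-- The matrix of the observable error dynamics. -/
def errA : Matrix (ObsIdx n) (ObsIdx n) ℝ := E.Ao * (1 - H * E.Co)

/-- The gain through which the innovation enters the estimate of the ensemble mean. -/
def meanGain : Matrix (Fin 2) (Fin n) ℝ := clockA E.τ * (duplRow t * H)

/-- The closed-loop matrix of the ensemble mean. -/
def meanA (k : ℕ) : Matrix (Fin 2) (Fin 2) ℝ :=
  clockA E.τ - Matrix.vecMulVec (clockB E.τ) (c.Fb k)

lemma dupl_V_mulVec_AN (x : Idx n → ℝ) :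
    dupl E.V *ᵥ (E.AN *ᵥ x) = E.Ao *ᵥ (dupl E.V *ᵥ x) := by
  rw [Matrix.mulVec_mulVec, Matrix.mulVec_mulVec]
  exact congrArg (· *ᵥ x) (bigA_mul_dupl E.τ E.V).symm

lemma dupl_V_mulVec_BN (u : Fin (n + 1) → ℝ) :
    dupl E.V *ᵥ (E.BN *ᵥ u) = E.Bo *ᵥ (E.V *ᵥ u) := by
  rw [Matrix.mulVec_mulVec, Matrix.mulVec_mulVec]
  exact congrArg (· *ᵥ u) (dupl_mul_bigB E.τ E.V)

lemma duplRow_mulVec_AN (q : Fin (n + 1) → ℝ) (x : Idx n → ℝ) :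
    duplRow q *ᵥ (E.AN *ᵥ x) = clockA E.τ *ᵥ (duplRow q *ᵥ x) := by
  rw [Matrix.mulVec_mulVec, Matrix.mulVec_mulVec]
  exact congrArg (· *ᵥ x) (duplRow_mul_bigA E.τ q)

lemma duplRow_mulVec_Ao (t : Fin n → ℝ) (x : ObsIdx n → ℝ) :
    duplRow t *ᵥ (E.Ao *ᵥ x) = clockA E.τ *ᵥ (duplRow t *ᵥ x) := by
  rw [Matrix.mulVec_mulVec, Matrix.mulVec_mulVec]
  exact congrArg (· *ᵥ x) (duplRow_mul_bigA E.τ t)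

section Coordinates

variable (k : ℕ) (v : Idx n → ℝ) (w : Fin n → ℝ) (s : LoopState n)

lemma innovation_eq :
    E.CN *ᵥ s.x + w - E.Co *ᵥ s.ξo = E.Co *ᵥ E.obsErr s + w := by
  rw [CN_eq, obsErr, Matrix.mulVec_sub, Matrix.mulVec_mulVec]
  abel

lemma step_ξo (G : Matrix (Fin 2) (Fin n) ℝ) : (E.step W (H, G) c k v w s).ξo =
    (E.Ao - E.Bo * c.Fo) *ᵥ s.ξo + (E.Ao * H) *ᵥ (E.Co *ᵥ E.obsErr s + w) := by
  simp only [step, innovation_eq, Matrix.mulVec_neg, Matrix.sub_mulVec, ← Matrix.mulVec_mulVec]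
  abel

lemma step_ξb : (E.step W (H, duplRow t * H) c k v w s).ξb =
    E.meanA c k *ᵥ s.ξb + E.meanGain H t *ᵥ (E.Co *ᵥ E.obsErr s + w) := by
  simp only [step, innovation_eq, meanA, meanGain, Matrix.sub_mulVec, Matrix.vecMulVec_mulVec,
    op_smul_eq_smul, neg_smul]
  abel

variable (hq : ∑ i, q i = 1) (hqW : q ᵥ* W = 0) (hW : W.rank = n)
include hq hqW hW

lemma step_obsErr (G : Matrix (Fin 2) (Fin n) ℝ) : E.obsErr (E.step W (H, G) c k v w s) =
    E.errA H *ᵥ E.obsErr s + (dupl E.V *ᵥ v - (E.Ao * H) *ᵥ w) := by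
  have hV1 (x : Fin n → ℝ) : E.V *ᵥ (E.Vplus W *ᵥ x) = x := by
    rw [Matrix.mulVec_mulVec, E.V_mul_Vplus hq hqW hW, Matrix.one_mulVec]
  have hV2 (a : ℝ) : E.V *ᵥ (a • (1 : Fin (n + 1) → ℝ)) = 0 := by
    rw [Matrix.mulVec_smul, E.V_mulVec_one, smul_zero]
  rw [obsErr, step_ξo]
  simp only [step, Matrix.mulVec_add, E.dupl_V_mulVec_AN, E.dupl_V_mulVec_BN, hV1, hV2,
    errA, Matrix.mulVec_zero, Matrix.mulVec_neg, Matrix.sub_mulVec, Matrix.mul_sub, Matrix.mul_one,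
    ← Matrix.mulVec_mulVec]
  simp only [obsErr, Matrix.mulVec_sub]
  abel

/-- The control enters the mean and its estimate equally. The identity tᵀV = qᵀ - q_∞ᵀ removes the
process noise, and the gain (I₂ ⊗ tᵀ)H removes the innovation, measurement noise included. -/
lemma step_meanErr (ht : t ᵥ* E.V = q - E.qInf) (r : Fin 2 → ℝ) :
    E.meanErr t q (E.step W (H, duplRow t * H) c k v w s)
      (clockA E.τ *ᵥ r + duplRow E.qInf *ᵥ v) = clockA E.τ *ᵥ E.meanErr t q s r := by
  have hq1 (x : Fin n → ℝ) : q ⬝ᵥ E.Vplus W *ᵥ x = 0 := by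
    rw [Matrix.dotProduct_mulVec, E.vecMul_Vplus hqW, zero_dotProduct]
  have hq2 (a : ℝ) : q ⬝ᵥ a • (1 : Fin (n + 1) → ℝ) = a := by
    rw [dotProduct_smul, dotProduct_one, hq, smul_eq_mul, mul_one]
  have hqB (u : Fin (n + 1) → ℝ) : duplRow q *ᵥ (E.BN *ᵥ u) = (q ⬝ᵥ u) • clockB E.τ :=
    duplRow_mulVec_bigB _ _ _
  have htV : duplRow t *ᵥ (dupl E.V *ᵥ v) = duplRow q *ᵥ v - duplRow E.qInf *ᵥ v := by
    rw [Matrix.mulVec_mulVec, duplRow_mul_dupl, ht, duplRow_sub, Matrix.sub_mulVec]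
  rw [meanErr, E.step_obsErr c H k v w s hq hqW hW, step_ξb]
  simp only [step, Matrix.mulVec_add, Matrix.mulVec_sub, E.duplRow_mulVec_AN, hqB, hq1, hq2, htV,
    errA, zero_smul, dotProduct_neg, Matrix.mul_sub, Matrix.mul_one, Matrix.sub_mulVec,
    ← Matrix.mulVec_mulVec, E.duplRow_mulVec_Ao, meanA, meanGain, meanErr,
    Matrix.vecMulVec_mulVec, op_smul_eq_smul, neg_smul]
  abel

lemma sync_decomposition (r : Fin 2 → ℝ) : s.x - duplCol 1 *ᵥ r =
    dupl (E.Vplus W) *ᵥ (E.obsErr s + s.ξo) +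
      duplCol 1 *ᵥ (s.ξb + duplRow t *ᵥ E.obsErr s + E.meanErr t q s r) := by
  have h1 (x : Idx n → ℝ) :
      dupl (E.Vplus W) *ᵥ (dupl E.V *ᵥ x) + duplCol 1 *ᵥ (duplRow q *ᵥ x) = x := by
    ext ⟨a, i⟩
    have := congrFun (E.Vplus_mulVec_add hq hqW hW fun j => x (a, j)) i
    rw [Matrix.mulVec_mulVec, dupl_mul_dupl]
    rw [Matrix.mulVec_mulVec] at this
    rw [← this]
    fin_cases a <;>
      simp [dupl, duplCol, duplRow, Matrix.mulVec, dotProduct, Fintype.sum_prod_type,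
        -Matrix.mulVec_mulVec]
  have h2 : E.obsErr s + s.ξo = dupl E.V *ᵥ s.x := by rw [obsErr, sub_add_cancel]
  have h3 : s.ξb + duplRow t *ᵥ E.obsErr s + E.meanErr t q s r = duplRow q *ᵥ s.x - r := by
    rw [meanErr]
    abel
  rw [h2, h3, Matrix.mulVec_sub, ← add_sub_assoc, h1]

end Coordinates

/-- Feedback acts only at the first instant of a period; the other m - 1 steps are free. -/
lemma transition_meanA (hm : 1 ≤ c.m) : transition (E.meanA c) c.m = clockA E.τ ^ c.m -
    Matrix.vecMulVec (clockA E.τ ^ (c.m - 1) *ᵥ clockB E.τ) c.K := by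
  have h : ∀ j, j + 1 ≤ c.m → transition (E.meanA c) (j + 1) =
      clockA E.τ ^ j * (clockA E.τ - Matrix.vecMulVec (clockB E.τ) c.K) := by
    intro j hj
    induction j with
    | zero => simp [transition, meanA, Controller.Fb]
    | succ j ih =>
      have h0 : c.Fb (j + 1) = 0 := if_neg fun hd => by
        have := Nat.le_of_dvd (by omega) hd
        omega
      rw [transition, ih (by omega), meanA, h0, Matrix.vecMulVec_zero, sub_zero, pow_succ',
        Matrix.mul_assoc]
  obtain ⟨j, hj⟩ := Nat.exists_eq_add_of_le' hm
  rw [hj, h j hj.ge, Nat.add_sub_cancel, Matrix.mul_sub, pow_succ, Matrix.mul_vecMulVec]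

/-! ### Responses driven by the innovation -/

section Driven

variable {ι : Type*} [Fintype ι] (D : ℕ → Matrix ι ι ℝ) (K : Matrix ι (Fin n) ℝ)

/-- State matrix of the observable error together with a system driven by the innovation. -/
def drivenF (k : ℕ) : Matrix (ObsIdx n ⊕ ι) (ObsIdx n ⊕ ι) ℝ :=
  Matrix.fromBlocks (E.errA H) 0 (K * E.Co) (D k)

/-- Noise input matrix of the observable error together with a system driven by the innovation. -/
def drivenB : Matrix (ObsIdx n ⊕ ι) (Idx n ⊕ Fin n) ℝ :=
  Matrix.fromBlocks (dupl E.V) (-(E.Ao * H)) 0 K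

/-- Covariance of the joint noise. -/
noncomputable def noiseCov : Matrix (Idx n ⊕ Fin n) (Idx n ⊕ Fin n) ℝ :=
  Matrix.fromBlocks E.Q 0 0 E.R

lemma noiseCov_posDef : E.noiseCov.PosDef := posDef_fromBlocks_diag E.Q_posDef E.R_posDef

lemma isResponse_driven {Ω : Type*} {v : ℕ → Ω → Idx n → ℝ} {w : ℕ → Ω → Fin n → ℝ}
    {e : ℕ → Ω → ObsIdx n → ℝ} {η : ℕ → Ω → ι → ℝ} {e₀ : ObsIdx n → ℝ} {η₀ : ι → ℝ}
    (he₀ : ∀ ω, e 0 ω = e₀) (hη₀ : ∀ ω, η 0 ω = η₀)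
    (he : ∀ k ω, e (k + 1) ω =
      E.errA H *ᵥ e k ω + (dupl E.V *ᵥ v k ω - (E.Ao * H) *ᵥ w k ω))
    (hη : ∀ k ω, η (k + 1) ω = D k *ᵥ η k ω + K *ᵥ (E.Co *ᵥ e k ω + w k ω)) :
    IsResponse (E.drivenF H D K) (E.drivenB H K) (fun k ω => Sum.elim (v k ω) (w k ω))
      (Sum.elim e₀ η₀) (fun k ω => Sum.elim (e k ω) (η k ω)) := by
  refine ⟨fun ω => by rw [he₀, hη₀], fun k ω => ?_⟩
  rw [he, hη, drivenF, drivenB, Matrix.fromBlocks_mulVec, Matrix.fromBlocks_mulVec]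
  ext (a | a)
  · simp [Matrix.neg_mulVec, sub_eq_add_neg]
  · simp [Matrix.mulVec_add, Matrix.mulVec_mulVec]
    ring

lemma transition_drivenF [DecidableEq ι] (k : ℕ) : ∃ Y, transition (E.drivenF H D K) k =
    Matrix.fromBlocks (E.errA H ^ k) 0 Y (transition D k) := by
  obtain ⟨Y, hY⟩ := transition_fromBlocks (fun _ => E.errA H) (fun _ => K * E.Co) D k
  exact ⟨Y, by rw [← transition_const]; exact hY⟩

end Driven

end Ensemble

/-! ### Eigenvalues outside the unit disk that the free motion can compensate -/

section Compensation

/-- Shifting the index shows that the limit -c of z^k x is fixed by multiplication by z. If z ≠ 1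
then c = 0, contradicting ‖z^k x‖ ≥ ‖x‖. -/
lemma eq_one_of_tendsto_pow_mul_add {z x c : ℂ} (hz : 1 ≤ ‖z‖) (hx : x ≠ 0)
    (h : Tendsto (fun k : ℕ => z ^ k * x + c) atTop (𝓝 0)) : z = 1 := by
  have h1 : Tendsto (fun k : ℕ => z ^ k * x) atTop (𝓝 (-c)) := by
    simpa using h.sub_const c
  have h2 : Tendsto (fun k : ℕ => z * (z ^ k * x)) atTop (𝓝 (-c)) := by
    simpa [pow_succ', mul_assoc] using (tendsto_add_atTop_iff_nat 1).2 h1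
  have h3 := tendsto_nhds_unique h2 (h1.const_mul z)
  by_contra hne
  have hc : c = 0 := by
    have : (z - 1) * c = 0 := by linear_combination h3
    exact (mul_eq_zero.1 this).resolve_left (sub_ne_zero.2 hne)
  rw [hc, neg_zero] at h1
  have h4 : ‖x‖ ≤ 0 := by
    refine ge_of_tendsto' (by simpa using h1.norm) fun k => ?_
    rw [← norm_pow] at *
    have := one_le_pow₀ hz (n := k)
    calc ‖x‖ = 1 * ‖x‖ := (one_mul _).symm
      _ ≤ ‖z ^ k‖ * ‖x‖ := by rw [norm_pow]; gcongr
  exact hx (norm_le_zero_iff.1 h4)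

lemma eq_zero_of_tendsto_add_nat_mul {c d : ℂ}
    (h : Tendsto (fun k : ℕ => c + k * d) atTop (𝓝 0)) : d = 0 := by
  have h1 := ((tendsto_add_atTop_iff_nat 1).2 h).sub h
  have h2 : ∀ k : ℕ, c + ((k + 1 : ℕ) : ℂ) * d - (c + k * d) = d := fun k => by
    push_cast
    ring
  simp_rw [h2, sub_zero] at h1
  exact tendsto_nhds_unique tendsto_const_nhds h1

lemma clockA_pow_mulVec (τ : ℝ) (k : ℕ) (p : Fin 2 → ℝ) :
    clockA τ ^ k *ᵥ p = ![p 0 + k * τ * p 1, p 1] := by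
  rw [clockA_pow]
  ext a
  fin_cases a <;> simp [Matrix.mulVec, dotProduct]

/-- Free motion has constant frequency and affine phase. A constant can offset z^k only when z = 1;
an eigenvector with nonzero frequency would then require a drift in phase, which nothing cancels. -/
lemma eigenvector_of_compensated {τ : ℝ} (hτ : τ ≠ 0) {m : ℕ} (hm : m ≠ 0)
    {Φ : Matrix (Fin 2) (Fin 2) ℝ}
    (hΦ : ∀ η, ∃ p, Tendsto (fun k => Φ ^ k *ᵥ η + clockA τ ^ (m * k) *ᵥ p) atTop (𝓝 0))
    {z : ℂ} {x : Fin 2 → ℂ} (hx : x ≠ 0) (hzx : Φ.map (algebraMap ℝ ℂ) *ᵥ x = z • x)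
    (hz : 1 ≤ ‖z‖) : z = 1 ∧ x 1 = 0 := by
  obtain ⟨p, hp⟩ := hΦ fun j => (x j).re
  obtain ⟨p', hp'⟩ := hΦ fun j => (x j).im
  simp_rw [clockA_pow_mulVec] at hp hp'
  have key (i : Fin 2) : Tendsto (fun k : ℕ => z ^ k * x i +
      (((![p 0 + (m * k : ℕ) * τ * p 1, p 1] : Fin 2 → ℝ) i : ℂ) +
        ((![p' 0 + (m * k : ℕ) * τ * p' 1, p' 1] : Fin 2 → ℝ) i : ℂ) * Complex.I)) atTop (𝓝 0) := by
    have h1 := (Complex.continuous_ofReal.tendsto _).comp (tendsto_pi_nhds.1 hp i)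
    have h2 := (Complex.continuous_ofReal.tendsto _).comp (tendsto_pi_nhds.1 hp' i)
    have h3 := h1.add (h2.mul_const Complex.I)
    simp only [Pi.zero_apply, Complex.ofReal_zero, zero_mul, add_zero] at h3
    refine h3.congr fun k => ?_
    have h4 := mulVec_re_im (Φ ^ k) x i
    rw [Matrix.map_pow, map_pow_mulVec_eigenvector hzx, Pi.smul_apply, smul_eq_mul] at h4
    rw [h4]
    simp only [Function.comp_apply, Pi.add_apply, Complex.ofReal_add]
    ring
  set a : ℂ := p 0 + p' 0 * Complex.I
  set b : ℂ := p 1 + p' 1 * Complex.I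
  have k1 : Tendsto (fun k : ℕ => z ^ k * x 1 + b) atTop (𝓝 0) := by
    simpa [b] using key 1
  have k0 : Tendsto (fun k : ℕ => z ^ k * x 0 + (a + k * (m * τ * b))) atTop (𝓝 0) := by
    refine (key 0).congr fun k => ?_
    simp [a, b]
    ring
  have hb : z = 1 → b = 0 := by
    rintro rfl
    have h1 : Tendsto (fun k : ℕ => (x 0 + a) + k * (m * τ * b)) atTop (𝓝 0) :=
      k0.congr fun k => by ring
    have h2 := eq_zero_of_tendsto_add_nat_mul h1
    have hm' : (m : ℂ) ≠ 0 := by exact_mod_cast hm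
    have hτ' : (τ : ℂ) ≠ 0 := by exact_mod_cast hτ
    simpa [hm', hτ'] using h2
  have hx1 : x 1 = 0 := by
    by_contra h0
    have hz1 := eq_one_of_tendsto_pow_mul_add hz h0 k1
    rw [hb hz1, hz1] at k1
    simp only [one_pow, one_mul, add_zero] at k1
    exact h0 (tendsto_nhds_unique tendsto_const_nhds k1)
  have hb0 : b = 0 := by
    simp only [hx1, mul_zero, zero_add] at k1
    exact tendsto_nhds_unique tendsto_const_nhds k1
  have hx0 : x 0 ≠ 0 := fun h0 => hx <| by
    ext i
    fin_cases i
    · exact h0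
    · exact hx1
  simp only [hb0, mul_zero, add_zero] at k0
  exact ⟨eq_one_of_tendsto_pow_mul_add hz hx0 k0, hx1⟩

/-- The period matrix `A^m - A^{m-1} B Kᵀ` of the ensemble mean, entrywise. -/
lemma period_matrix_eq (τ : ℝ) {m : ℕ} (hm : 1 ≤ m) (K : Fin 2 → ℝ) :
    clockA τ ^ m - Matrix.vecMulVec (clockA τ ^ (m - 1) *ᵥ clockB τ) K =
      !![1 - m * τ * K 0, m * τ - m * τ * K 1; -K 0, 1 - K 1] := by
  obtain ⟨j, rfl⟩ := Nat.exists_eq_add_of_le' hm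
  rw [Nat.add_sub_cancel, clockA_pow_mulVec, clockA_pow]
  ext a b
  rw [Matrix.sub_apply, Matrix.vecMulVec_apply]
  fin_cases a <;> fin_cases b <;> simp [clockB, add_mul, sub_eq_add_neg, add_assoc, add_comm]

lemma gain_of_compensated {τ : ℝ} (hτ : 0 < τ) {m : ℕ} (hm : 1 ≤ m) {K : Fin 2 → ℝ}
    {Φ : Matrix (Fin 2) (Fin 2) ℝ}
    (hK : Φ = clockA τ ^ m - Matrix.vecMulVec (clockA τ ^ (m - 1) *ᵥ clockB τ) K)
    (hΦ : ∀ η, ∃ p, Tendsto (fun k => Φ ^ k *ᵥ η + clockA τ ^ (m * k) *ᵥ p) atTop (𝓝 0))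
    (hns : ¬ IsSchur Φ) : K 0 = 0 ∧ 0 ≤ K 1 := by
  have hm0 : m ≠ 0 := by omega
  rw [period_matrix_eq τ hm] at hK
  rw [isSchur_iff_eigenvector] at hns
  push Not at hns
  obtain ⟨z, x, hx, hzx, hz⟩ := hns
  obtain ⟨rfl, hx1⟩ := eigenvector_of_compensated hτ.ne' hm0 hΦ hx hzx hz
  have hx0 : x 0 ≠ 0 := fun h0 => hx <| by
    ext i
    fin_cases i
    · exact h0
    · exact hx1
  have hK0 : K 0 = 0 := by
    have h1 := congrFun hzx 1
    simpa [hK, Matrix.mulVec, dotProduct, hx1, hx0] using h1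
  refine ⟨hK0, ?_⟩
  by_contra! hneg
  have hmτ : (0 : ℝ) < m * τ := by positivity
  -- With K₀ = 0 the period matrix is upper triangular with diagonal 1, 1 - K₁. A negative K₁ would
  -- give a second eigenvalue above 1, displayed with its eigenvector, which free motion cannot
  -- offset.
  have h2 := eigenvector_of_compensated hτ.ne' hm0 hΦ (z := ((1 - K 1 : ℝ) : ℂ))
    (x := ![((m * τ * (1 - K 1) : ℝ) : ℂ), ((-K 1 : ℝ) : ℂ)]) ?_ ?_ ?_
  · have h3 : 1 - K 1 = 1 := by exact_mod_cast h2.1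
    linarith
  · intro h0
    have h3 := congrFun h0 1
    simp at h3
    exact hneg.ne h3
  · rw [hK]
    ext i
    fin_cases i
    · simp [Matrix.mulVec, dotProduct, hK0]
      ring
    · simp [Matrix.mulVec, dotProduct, hK0]
  · rw [Complex.norm_real, Real.norm_eq_abs, abs_of_pos (by linarith)]
    linarith

end Compensation

namespace Ensemble

variable {n : ℕ} (E : Ensemble n) {q : Fin (n + 1) → ℝ} {W : Matrix (Fin (n + 1)) (Fin n) ℝ}
  (c : Controller n) {H : Matrix (ObsIdx n) (Fin n) ℝ} {t : Fin n → ℝ}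

/-! ### Noise excitation of the ensemble mean -/

/-- A vanishing sum of nonnegative variances kills every term. Each noise injection forces γ = 0 and
annihilates the gain, so the pulled-back row again has no observable part; following it to the
earliest injection produces the power A^j. -/
lemma vecMul_eq_zero_of_accumulatedCov (hq : ∑ i, q i = 1) (hqW : q ᵥ* W = 0) (hW : W.rank = n)
    {j : ℕ} (hj1 : 1 ≤ j) (hjm : j ≤ c.m) {γ : ObsIdx n → ℝ} {l : Fin 2 → ℝ}
    (h : Sum.elim γ l ⬝ᵥ accumulatedCov (E.drivenF H (E.meanA c) (E.meanGain H t))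
      (E.drivenB H (E.meanGain H t) * E.noiseCov * (E.drivenB H (E.meanGain H t))ᵀ) j *ᵥ
        Sum.elim γ l = 0) :
    γ = 0 ∧ l ᵥ* (clockA E.τ ^ j * (duplRow t * H)) = 0 := by
  have hnoise : ∀ {γ : ObsIdx n → ℝ} {l : Fin 2 → ℝ},
      Sum.elim γ l ⬝ᵥ (E.drivenB H (E.meanGain H t) * E.noiseCov *
        (E.drivenB H (E.meanGain H t))ᵀ) *ᵥ Sum.elim γ l = 0 →
      γ = 0 ∧ l ᵥ* E.meanGain H t = 0 := by
    intro γ l h0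
    have h1 := vecMul_eq_zero_of_quad E.noiseCov_posDef h0
    rw [drivenB, Matrix.vecMul_fromBlocks] at h1
    have h2 : γ ᵥ* dupl E.V = 0 := by
      ext i
      simpa using congrFun h1 (Sum.inl i)
    have h3 : γ = 0 := E.vecMul_dupl_V_injective hq hqW hW (by simpa using h2)
    refine ⟨h3, ?_⟩
    ext i
    simpa [h3] using congrFun h1 (Sum.inr i)
  induction j, hj1 using Nat.le_induction generalizing γ l with
  | base =>
    have h1 := hnoise (by simpa [accumulatedCov] using h)
    rwa [meanGain, ← pow_one (clockA E.τ)] at h1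
  | succ j hj ih =>
    have hD : (E.drivenB H (E.meanGain H t) * E.noiseCov *
      (E.drivenB H (E.meanGain H t))ᵀ).PosSemidef :=
      posSemidef_conj E.noiseCov_posDef.posSemidef _
    rw [accumulatedCov, Matrix.add_mulVec, dotProduct_add, quad_conj, Matrix.mulVec_transpose] at h
    have h1 := posSemidef_quad_nonneg hD (Sum.elim γ l)
    have h2 := posSemidef_quad_nonneg (accumulatedCov_posSemidef
      (E.drivenF H (E.meanA c) (E.meanGain H t)) hD j)
      (Sum.elim γ l ᵥ* E.drivenF H (E.meanA c) (E.meanGain H t) j)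
    obtain ⟨hγ, hl⟩ := hnoise (by linarith)
    have h3 : Sum.elim γ l ᵥ* E.drivenF H (E.meanA c) (E.meanGain H t) j =
        Sum.elim (0 : ObsIdx n → ℝ) (l ᵥ* clockA E.τ) := by
      -- Here 1 ≤ j < m. The only factor containing K, at time 0, multiplies the zero initial
      -- covariance, so the feedback gain does not enter.
      have h0 : c.Fb j = 0 := if_neg fun hd => by
        have := Nat.le_of_dvd (by omega) hd
        omega
      rw [drivenF, Matrix.vecMul_fromBlocks, meanA, h0, Matrix.vecMulVec_zero, sub_zero, hγ,
        Sum.elim_comp_inl, Sum.elim_comp_inr, ← Matrix.vecMul_vecMul, hl]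
      ext (i | i) <;> simp
    have h4 := (ih (γ := 0) (l := l ᵥ* clockA E.τ) (by omega) (by rw [← h3]; linarith)).2
    exact ⟨hγ, by rwa [Matrix.vecMul_vecMul, ← Matrix.mul_assoc, ← pow_succ'] at h4⟩

/-! ### The closed loop as driven linear systems -/

section Loop

variable {Ω : Type*} (hq : ∑ i, q i = 1) (hqW : q ᵥ* W = 0) (hW : W.rank = n)
  {v : ℕ → Ω → Idx n → ℝ} {w : ℕ → Ω → Fin n → ℝ} (s₀ : LoopState n)

/-- The closed loop with noise realization `ω`, for gains of the form `(H, (I₂ ⊗ tᵀ) H)`. -/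
noncomputable def loopAt (W : Matrix (Fin (n + 1)) (Fin n) ℝ) (H : Matrix (ObsIdx n) (Fin n) ℝ)
    (t : Fin n → ℝ) (v : ℕ → Ω → Idx n → ℝ) (w : ℕ → Ω → Fin n → ℝ) (s₀ : LoopState n) (k : ℕ)
    (ω : Ω) : LoopState n :=
  E.loop W (H, duplRow t * H) c (fun l => v l ω) (fun l => w l ω) s₀ k

include hq hqW hW

lemma obsErr_loopAt (k : ℕ) (ω : Ω) : E.obsErr (E.loopAt c W H t v w s₀ (k + 1) ω) =
    E.errA H *ᵥ E.obsErr (E.loopAt c W H t v w s₀ k ω) +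
      (dupl E.V *ᵥ v k ω - (E.Ao * H) *ᵥ w k ω) :=
  E.step_obsErr c H k (v k ω) (w k ω) _ hq hqW hW _

lemma meanErr_loopAt (ht : t ᵥ* E.V = q - E.qInf) (r₀ : Fin 2 → ℝ) (k : ℕ) (ω : Ω) :
    E.meanErr t q (E.loopAt c W H t v w s₀ k ω) (E.freeMean E.qInf (fun l => v l ω) r₀ k) =
      clockA E.τ ^ k *ᵥ E.meanErr t q s₀ r₀ := by
  induction k with
  | zero => simp [loopAt, loop, freeMean]
  | succ k ih =>
    rw [pow_succ', ← Matrix.mulVec_mulVec, ← ih]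
    exact E.step_meanErr c H t k (v k ω) (w k ω) _ hq hqW hW ht _

lemma isResponse_obsErr :
    IsResponse (fun _ => E.errA H) (Matrix.fromCols (dupl E.V) (-(E.Ao * H)))
      (fun k ω => Sum.elim (v k ω) (w k ω)) (E.obsErr s₀)
      (fun k ω => E.obsErr (E.loopAt c W H t v w s₀ k ω)) := by
  refine ⟨fun ω => rfl, fun k ω => ?_⟩
  rw [E.obsErr_loopAt c hq hqW hW, Matrix.fromCols_mulVec_sumElim, Matrix.neg_mulVec,
    sub_eq_add_neg]

lemma isResponse_ξo :
    IsResponse (E.drivenF H (fun _ => E.Ao - E.Bo * c.Fo) (E.Ao * H)) (E.drivenB H (E.Ao * H))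
      (fun k ω => Sum.elim (v k ω) (w k ω)) (Sum.elim (E.obsErr s₀) s₀.ξo)
      (fun k ω => Sum.elim (E.obsErr (E.loopAt c W H t v w s₀ k ω))
        (E.loopAt c W H t v w s₀ k ω).ξo) :=
  E.isResponse_driven H _ _ (fun _ => rfl) (fun _ => rfl) (E.obsErr_loopAt c hq hqW hW s₀)
    fun k ω => E.step_ξo c H k (v k ω) (w k ω) _ _

lemma isResponse_ξb :
    IsResponse (E.drivenF H (E.meanA c) (E.meanGain H t)) (E.drivenB H (E.meanGain H t))
      (fun k ω => Sum.elim (v k ω) (w k ω)) (Sum.elim (E.obsErr s₀) s₀.ξb)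
      (fun k ω => Sum.elim (E.obsErr (E.loopAt c W H t v w s₀ k ω))
        (E.loopAt c W H t v w s₀ k ω).ξb) :=
  E.isResponse_driven H _ _ (fun _ => rfl) (fun _ => rfl) (E.obsErr_loopAt c hq hqW hW s₀)
    fun k ω => E.step_ξb c H t k (v k ω) (w k ω) _

lemma isResponse_loop :
    IsResponse (E.drivenF H (fun k => Matrix.fromBlocks (E.Ao - E.Bo * c.Fo) 0 0 (E.meanA c k))
      (Matrix.fromRows (E.Ao * H) (E.meanGain H t)))
      (E.drivenB H (Matrix.fromRows (E.Ao * H) (E.meanGain H t)))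
      (fun k ω => Sum.elim (v k ω) (w k ω))
      (Sum.elim (E.obsErr s₀) (Sum.elim s₀.ξo s₀.ξb))
      (fun k ω => Sum.elim (E.obsErr (E.loopAt c W H t v w s₀ k ω))
        (Sum.elim (E.loopAt c W H t v w s₀ k ω).ξo (E.loopAt c W H t v w s₀ k ω).ξb)) := by
  refine E.isResponse_driven H _ _ (fun _ => rfl) (fun _ => rfl) (E.obsErr_loopAt c hq hqW hW s₀)
    fun k ω => ?_
  have h1 : (E.loopAt c W H t v w s₀ (k + 1) ω).ξo = _ :=
    E.step_ξo (W := W) c H k (v k ω) (w k ω) (E.loopAt c W H t v w s₀ k ω) (duplRow t * H)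
  have h2 : (E.loopAt c W H t v w s₀ (k + 1) ω).ξb = _ :=
    E.step_ξb (W := W) c H t k (v k ω) (w k ω) (E.loopAt c W H t v w s₀ k ω)
  rw [Matrix.fromBlocks_mulVec, Matrix.fromRows_mulVec]
  ext (a | a)
  · simpa using congrFun h1 a
  · simpa using congrFun h2 a

lemma syncError_eq (ht : t ᵥ* E.V = q - E.qInf) (r₀ : Fin 2 → ℝ) (k : ℕ) (ω : Ω) :
    E.syncError W (H, duplRow t * H) c E.qInf v w s₀ r₀ k ω =
      dupl (E.Vplus W) *ᵥ (E.obsErr (E.loopAt c W H t v w s₀ k ω) +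
        (E.loopAt c W H t v w s₀ k ω).ξo) +
      duplCol 1 *ᵥ ((E.loopAt c W H t v w s₀ k ω).ξb +
        duplRow t *ᵥ E.obsErr (E.loopAt c W H t v w s₀ k ω) +
          clockA E.τ ^ k *ᵥ E.meanErr t q s₀ r₀) := by
  rw [← E.meanErr_loopAt c hq hqW hW s₀ ht r₀ k ω]
  exact E.sync_decomposition t _ hq hqW hW _

lemma dupl_V_mulVec_syncError (ht : t ᵥ* E.V = q - E.qInf) (r₀ : Fin 2 → ℝ) (k : ℕ) (ω : Ω) :
    dupl E.V *ᵥ E.syncError W (H, duplRow t * H) c E.qInf v w s₀ r₀ k ω =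
      E.obsErr (E.loopAt c W H t v w s₀ k ω) + (E.loopAt c W H t v w s₀ k ω).ξo := by
  rw [E.syncError_eq c hq hqW hW s₀ ht, Matrix.mulVec_add, Matrix.mulVec_mulVec,
    Matrix.mulVec_mulVec, dupl_mul_dupl, E.V_mul_Vplus hq hqW hW, dupl_one, dupl_mul_duplCol,
    E.V_mulVec_one]
  have : duplCol (0 : Fin n → ℝ) = 0 := by
    ext a b
    simp [duplCol]
  simp [this]

lemma duplRow_mulVec_syncError (ht : t ᵥ* E.V = q - E.qInf) (r₀ : Fin 2 → ℝ) (k : ℕ) (ω : Ω) :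
    duplRow q *ᵥ E.syncError W (H, duplRow t * H) c E.qInf v w s₀ r₀ k ω =
      (E.loopAt c W H t v w s₀ k ω).ξb + duplRow t *ᵥ E.obsErr (E.loopAt c W H t v w s₀ k ω) +
        clockA E.τ ^ k *ᵥ E.meanErr t q s₀ r₀ := by
  rw [E.syncError_eq c hq hqW hW s₀ ht, Matrix.mulVec_add, Matrix.mulVec_mulVec,
    Matrix.mulVec_mulVec, duplRow_mul_dupl, E.vecMul_Vplus hqW, duplRow_zero,
    duplRow_mul_duplCol, dotProduct_one, hq, one_smul, Matrix.zero_mulVec, zero_add,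
    Matrix.one_mulVec]

end Loop

end Ensemble

/-! ### Mean-square bounds -/

section

variable {Ω : Type*} [MeasurableSpace Ω] {P : Measure Ω}

lemma exists_integral_sq_le {ι : Type*} [Fintype ι] {X : ℕ → Ω → ι → ℝ} {Y : Matrix ι ι ℝ}
    (hX : ∀ k a, MemLp (fun ω => X k ω a) 2 P)
    (h : Tendsto (fun k => crossMoment P (X k) (X k)) atTop (𝓝 Y)) (x : ι → ℝ) :
    ∃ b, ∀ k, ∫ ω, (x ⬝ᵥ X k ω) ^ 2 ∂P ≤ b := by
  have hc : Continuous fun M : Matrix ι ι ℝ => x ⬝ᵥ M *ᵥ x := by fun_prop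
  obtain ⟨b, hb⟩ := ((hc.tendsto Y).comp h).bddAbove_range
  exact ⟨b, fun k => by rw [← quad_crossMoment (hX k)]; exact hb ⟨k, rfl⟩⟩

lemma memLp_dotProduct {ι : Type*} [Fintype ι] {X : Ω → ι → ℝ}
    (hX : ∀ a, MemLp (fun ω => X ω a) 2 P) (x : ι → ℝ) : MemLp (fun ω => x ⬝ᵥ X ω) 2 P :=
  memLp_finsetSum _ fun i _ => (hX i).const_mul (x i)

end

/-! ### Sufficiency and necessity of the two stability conditions -/

namespace Ensemble

variable {n : ℕ} (E : Ensemble n) {q : Fin (n + 1) → ℝ} {W : Matrix (Fin (n + 1)) (Fin n) ℝ}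
  (c : Controller n) {H : Matrix (ObsIdx n) (Fin n) ℝ} {t : Fin n → ℝ}
  {Ω : Type*} [MeasurableSpace Ω] {P : Measure Ω} [IsProbabilityMeasure P]

/-- With zero initial observable error the off-diagonal block of the transition matrix acts on
nothing, so the means decouple. -/
lemma integral_of_isResponse_driven {ι : Type*} [Fintype ι] [DecidableEq ι]
    {D : ℕ → Matrix ι ι ℝ} {K : Matrix ι (Fin n) ℝ} {ν : ℕ → Ω → Idx n ⊕ Fin n → ℝ}
    {S : Matrix (Idx n ⊕ Fin n) (Idx n ⊕ Fin n) ℝ} {e : ℕ → Ω → ObsIdx n → ℝ}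
    {η : ℕ → Ω → ι → ℝ} {η₀ : ι → ℝ}
    (h : IsResponse (E.drivenF H D K) (E.drivenB H K) ν (Sum.elim 0 η₀)
      (fun k ω => Sum.elim (e k ω) (η k ω))) (hν : IsWhiteGaussian ν S P) (k : ℕ) :
    (fun a => ∫ ω, e k ω a ∂P) = 0 ∧ (fun a => ∫ ω, η k ω a ∂P) = transition D k *ᵥ η₀ := by
  obtain ⟨Y, hY⟩ := E.transition_drivenF H D K k
  have h1 := h.mean hν k
  rw [hY, Matrix.fromBlocks_mulVec, Sum.elim_comp_inl, Sum.elim_comp_inr] at h1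
  constructor
  · ext a
    simpa using congrFun h1 (Sum.inl a)
  · ext a
    simpa using congrFun h1 (Sum.inr a)

variable (hq : ∑ i, q i = 1) (hqW : q ᵥ* W = 0) (hW : W.rank = n) (ht : t ᵥ* E.V = q - E.qInf)
  (hm : 1 ≤ c.m) (herr : Tendsto (fun k => E.errA H ^ k) atTop (𝓝 0))
  {v : ℕ → Ω → Idx n → ℝ} {w : ℕ → Ω → Fin n → ℝ}
  (hν : IsWhiteGaussian (fun k ω => Sum.elim (v k ω) (w k ω)) E.noiseCov P)
include hq hqW hW ht hm herr hν

theorem achievesSync_of_isSchur (h₁ : IsSchur (E.Ao - E.Bo * c.Fo))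
    (h₂ : IsSchur (transition (E.meanA c) c.m)) :
    E.AchievesSync P W (H, duplRow t * H) c E.qInf v w := by
  intro s₀
  -- This r₀ makes `meanErr` vanish initially, hence at all times, which removes the unstable free
  -- motion from δ.
  refine ⟨duplRow q *ᵥ s₀.x - s₀.ξb - duplRow t *ᵥ E.obsErr s₀, ?_⟩
  have h0 : E.meanErr t q s₀ (duplRow q *ᵥ s₀.x - s₀.ξb - duplRow t *ᵥ E.obsErr s₀) = 0 := by
    rw [meanErr]
    abel
  have hm0 : c.m ≠ 0 := by omega
  have hz := E.isResponse_loop c (H := H) (t := t) hq hqW hW (v := v) (w := w) s₀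
  obtain ⟨Y, hY⟩ := E.transition_drivenF H
    (fun k => Matrix.fromBlocks (E.Ao - E.Bo * c.Fo) 0 0 (E.meanA c k))
    (Matrix.fromRows (E.Ao * H) (E.meanGain H t)) c.m
  obtain ⟨Y', hY'⟩ := transition_fromBlocks (fun _ => E.Ao - E.Bo * c.Fo) (fun _ => 0)
    (E.meanA c) c.m
  have hstab : IsSchur (transition (E.drivenF H
      (fun k => Matrix.fromBlocks (E.Ao - E.Bo * c.Fo) 0 0 (E.meanA c k))
      (Matrix.fromRows (E.Ao * H) (E.meanGain H t))) c.m) := by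
    rw [hY, hY', transition_const]
    exact isSchur_fromBlocks ((isSchur_of_tendsto_pow herr).pow hm0)
      (isSchur_fromBlocks (h₁.pow hm0) h₂ Y') Y
  convert hz.isSteadyStationary hν (m := c.m) ?_ hstab.tendsto_pow
    (Matrix.fromCols (dupl (E.Vplus W) + duplCol 1 * duplRow t)
      (Matrix.fromCols (dupl (E.Vplus W)) (duplCol 1))) using 3 with k ω
  · rw [E.syncError_eq c hq hqW hW s₀ ht, h0, Matrix.fromCols_mulVec_sumElim,
      Matrix.fromCols_mulVec_sumElim]
    simp only [Matrix.mulVec_add, Matrix.add_mulVec, Matrix.mulVec_zero, ← Matrix.mulVec_mulVec]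
    abel
  · intro k j
    simp only [drivenF, meanA, c.Fb_period]

omit hm herr in
/-- The means of the synchronization error, for a loop whose observable error starts at zero. -/
lemma tendsto_mean_syncError {s₀ : LoopState n} (h0 : E.obsErr s₀ = 0) {r₀ : Fin 2 → ℝ}
    (h : IsSteadyStationary
      (fun k => E.syncError W (H, duplRow t * H) c E.qInf v w s₀ r₀ (c.m * k)) P) :
    Tendsto (fun k => (E.Ao - E.Bo * c.Fo) ^ (c.m * k) *ᵥ s₀.ξo) atTop (𝓝 0) ∧
    Tendsto (fun k => transition (E.meanA c) c.m ^ k *ᵥ s₀.ξb +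
      clockA E.τ ^ (c.m * k) *ᵥ E.meanErr t q s₀ r₀) atTop (𝓝 0) := by
  have hLp := memLp_of_isGaussianProcess h.gaussian
  have hint k a := (hLp k a).integrable one_le_two
  have hmean : Tendsto (fun k a => ∫ ω, E.syncError W (H, duplRow t * H) c E.qInf v w s₀ r₀
      (c.m * k) ω a ∂P) atTop (𝓝 0) := tendsto_pi_nhds.2 h.mean
  have hlim {κ : Type} (L : Matrix κ (Idx n) ℝ) : Tendsto (fun k a => ∫ ω, (L *ᵥ
      E.syncError W (H, duplRow t * H) c E.qInf v w s₀ r₀ (c.m * k) ω) a ∂P) atTop (𝓝 0) := by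
    have hc : Continuous fun x : Idx n → ℝ => L *ᵥ x := by fun_prop
    have h1 := (hc.tendsto 0).comp hmean
    rw [Matrix.mulVec_zero] at h1
    refine h1.congr fun k => ?_
    ext a
    exact (integral_mulVec L (hint k) a).symm
  have hξo := E.isResponse_ξo c (H := H) (t := t) hq hqW hW (v := v) (w := w) s₀
  have hξb := E.isResponse_ξb c (H := H) (t := t) hq hqW hW (v := v) (w := w) s₀
  have he k a : Integrable (fun ω => E.obsErr (E.loopAt c W H t v w s₀ k ω) a) P :=
    (hξo.memLp hν k (Sum.inl a)).integrable one_le_two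
  have ho k a : Integrable (fun ω => (E.loopAt c W H t v w s₀ k ω).ξo a) P :=
    (hξo.memLp hν k (Sum.inr a)).integrable one_le_two
  have hb k a : Integrable (fun ω => (E.loopAt c W H t v w s₀ k ω).ξb a) P :=
    (hξb.memLp hν k (Sum.inr a)).integrable one_le_two
  have hte k a : Integrable
      (fun ω => (duplRow t *ᵥ E.obsErr (E.loopAt c W H t v w s₀ k ω)) a) P :=
    (memLp_mulVec _ (fun a => hξo.memLp hν k (Sum.inl a)) a).integrable one_le_two
  rw [h0] at hξo hξb
  constructor
  · refine (hlim (dupl E.V)).congr fun k => ?_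
    obtain ⟨h1, h2⟩ := E.integral_of_isResponse_driven hξo hν (c.m * k)
    ext a
    simp_rw [E.dupl_V_mulVec_syncError c hq hqW hW s₀ ht, Pi.add_apply]
    rw [integral_add (he _ _) (ho _ _), congrFun h1 a, congrFun h2 a, transition_const]
    simp
  · refine (hlim (duplRow q)).congr fun k => ?_
    obtain ⟨h1, h2⟩ := E.integral_of_isResponse_driven hξb hν (c.m * k)
    have hper : transition (E.meanA c) (c.m * k) = transition (E.meanA c) c.m ^ k :=
      transition_period (fun k j => by simp only [meanA, c.Fb_period]) k
    ext a
    simp_rw [E.duplRow_mulVec_syncError c hq hqW hW s₀ ht, Pi.add_apply]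
    have hbte : Integrable (fun ω => (E.loopAt c W H t v w s₀ (c.m * k) ω).ξb a +
        (duplRow t *ᵥ E.obsErr (E.loopAt c W H t v w s₀ (c.m * k) ω)) a) P :=
      (hb _ a).add (hte _ a)
    rw [integral_add hbte (integrable_const _), integral_add (hb _ _) (hte _ _),
      integral_mulVec _ (he _), h1, congrFun h2 a, hper]
    simp

-- Starting from x = V⁺ξ with the exact observable estimate ξ gives e = 0, and ξ is arbitrary.
omit herr in
lemma isSchur_of_achievesSync (h : E.AchievesSync P W (H, duplRow t * H) c E.qInf v w) :
    IsSchur (E.Ao - E.Bo * c.Fo) := by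
  refine isSchur_of_tendsto_mulVec (m := c.m) (by omega) fun ξ => ?_
  obtain ⟨r₀, hr⟩ := h ⟨dupl (E.Vplus W) *ᵥ ξ, ξ, 0⟩
  refine (E.tendsto_mean_syncError c hq hqW hW ht hν ?_ hr).1
  rw [obsErr, Matrix.mulVec_mulVec, dupl_mul_dupl, E.V_mul_Vplus hq hqW hW, dupl_one,
    Matrix.one_mulVec, sub_self]

omit hm herr in
lemma exists_compensation (h : E.AchievesSync P W (H, duplRow t * H) c E.qInf v w)
    (η : Fin 2 → ℝ) : ∃ p, Tendsto (fun k => transition (E.meanA c) c.m ^ k *ᵥ η +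
      clockA E.τ ^ (c.m * k) *ᵥ p) atTop (𝓝 0) := by
  obtain ⟨r₀, hr⟩ := h ⟨0, 0, η⟩
  exact ⟨_, (E.tendsto_mean_syncError c hq hqW hW ht hν (by simp [obsErr]) hr).2⟩

/-- A left fixed vector of the period matrix of the estimates kills the noise accumulated over a
period: otherwise the variance of the synchronization error would diverge. -/
lemma quad_accumulatedCov_eq_zero_of_achievesSync
    (h : E.AchievesSync P W (H, duplRow t * H) c E.qInf v w) {γ : ObsIdx n → ℝ} {l : Fin 2 → ℝ}
    (hx : Sum.elim γ l ᵥ* transition (E.drivenF H (E.meanA c) (E.meanGain H t)) c.m =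
      Sum.elim γ l) :
    Sum.elim γ l ⬝ᵥ accumulatedCov (E.drivenF H (E.meanA c) (E.meanGain H t))
      (E.drivenB H (E.meanGain H t) * E.noiseCov * (E.drivenB H (E.meanGain H t))ᵀ) c.m *ᵥ
        Sum.elim γ l = 0 := by
  set s₀ : LoopState n := ⟨0, 0, 0⟩ with hs
  have h0 : E.obsErr s₀ = 0 := by simp [obsErr, hs]
  obtain ⟨r₀, hr⟩ := h s₀
  -- From the zero state, convergence of the mean leaves only A^{mk}p → 0. Its frequency is
  -- constant, and with zero frequency so is its phase; hence p = 0.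
  have hp : E.meanErr t q s₀ r₀ = 0 := by
    have h1 := (E.tendsto_mean_syncError c hq hqW hW ht hν h0 hr).2
    simp only [hs, Matrix.mulVec_zero, zero_add] at h1
    rw [← hs] at h1
    set p := E.meanErr t q s₀ r₀
    simp_rw [clockA_pow_mulVec] at h1
    have h2 : p 1 = 0 := by
      have := tendsto_pi_nhds.1 h1 1
      exact tendsto_nhds_unique tendsto_const_nhds this
    have h3 : p 0 = 0 := by
      have := tendsto_pi_nhds.1 h1 0
      simp only [h2, mul_zero, add_zero] at this
      exact tendsto_nhds_unique tendsto_const_nhds this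
    ext a
    fin_cases a
    · exact h3
    · exact h2
  have hz := E.isResponse_ξb c (H := H) (t := t) hq hqW hW (v := v) (w := w) s₀
  have he := E.isResponse_obsErr c (H := H) (t := t) hq hqW hW (v := v) (w := w) s₀
  have heLp k a := he.memLp hν k a
  have hδLp := memLp_of_isGaussianProcess hr.gaussian
  obtain ⟨Y, hY⟩ := he.exists_tendsto_crossMoment hν (m := c.m) (fun _ _ => rfl) (by
    simp_rw [transition_const, ← pow_mul]
    exact herr.comp (tendsto_id.const_mul_atTop' hm))
  obtain ⟨r, hcov⟩ := hr.cov
  have hδ : Tendsto (fun k => crossMoment P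
      (E.syncError W (H, duplRow t * H) c E.qInf v w s₀ r₀ (c.m * k))
      (E.syncError W (H, duplRow t * H) c E.qInf v w s₀ r₀ (c.m * k))) atTop (𝓝 (r 0 0)) :=
    tendsto_pi_nhds.2 fun a => tendsto_pi_nhds.2 fun b => hcov 0 0 a b
  -- Since (I₂ ⊗ qᵀ)δ = ξ̂_ō + (I₂ ⊗ tᵀ)e when p = 0, the functional (γ, l) of (e, ξ̂_ō) is β on e
  -- plus α on δ. Both have bounded second moments, the first by stability of the filter, the second
  -- by assumption.
  set β := γ - l ᵥ* duplRow t
  set α := l ᵥ* duplRow q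
  obtain ⟨b₁, hb₁⟩ := exists_integral_sq_le (fun k a => heLp (c.m * k) a) hY β
  obtain ⟨b₂, hb₂⟩ := exists_integral_sq_le hδLp hδ α
  refine hz.quad_accumulatedCov_eq_zero hν E.noiseCov_posDef.posSemidef (m := c.m)
    (fun k j => by simp only [drivenF, meanA, c.Fb_period]) hx (b := 2 * b₁ + 2 * b₂) fun k => ?_
  have hdecomp ω : Sum.elim γ l ⬝ᵥ Sum.elim
      (E.obsErr (E.loopAt c W H t v w s₀ (c.m * k) ω)) (E.loopAt c W H t v w s₀ (c.m * k) ω).ξb =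
      β ⬝ᵥ E.obsErr (E.loopAt c W H t v w s₀ (c.m * k) ω) +
        α ⬝ᵥ E.syncError W (H, duplRow t * H) c E.qInf v w s₀ r₀ (c.m * k) ω := by
    rw [sumElim_dotProduct_sumElim, sub_dotProduct, ← Matrix.dotProduct_mulVec,
      ← Matrix.dotProduct_mulVec, E.duplRow_mulVec_syncError c hq hqW hW s₀ ht, hp,
      Matrix.mulVec_zero, add_zero, dotProduct_add]
    ring
  have h1 := (memLp_dotProduct (heLp (c.m * k)) β).integrable_sq
  have h2 := (memLp_dotProduct (hδLp k) α).integrable_sq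
  calc _ ≤ ∫ ω, (2 * (β ⬝ᵥ E.obsErr (E.loopAt c W H t v w s₀ (c.m * k) ω)) ^ 2 +
        2 * (α ⬝ᵥ E.syncError W (H, duplRow t * H) c E.qInf v w s₀ r₀ (c.m * k) ω) ^ 2) ∂P := by
        refine integral_mono_of_nonneg (.of_forall fun ω => sq_nonneg _)
          ((h1.const_mul 2).add (h2.const_mul 2)) (.of_forall fun ω => ?_)
        simp only [hdecomp]
        rw [← mul_add]
        exact add_sq_le
    _ ≤ _ := by
        rw [integral_add (h1.const_mul 2) (h2.const_mul 2), integral_const_mul, integral_const_mul]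
        linarith [hb₁ k, hb₂ k]

theorem isSchur_mean_of_achievesSync (h : E.AchievesSync P W (H, duplRow t * H) c E.qInf v w)
    (hgain : ∀ a : Fin 2 → ℝ, 0 ≤ a 0 * a 1 → a 1 ≠ 0 → a ᵥ* (duplRow t * H) ≠ 0) :
    IsSchur (transition (E.meanA c) c.m) := by
  by_contra hns
  have hΦ := E.transition_meanA c hm
  obtain ⟨hK0, hK1⟩ := gain_of_compensated E.τ_pos hm hΦ
    (E.exists_compensation c hq hqW hW ht hν h) hns
  rw [period_matrix_eq E.τ hm, hK0] at hΦ
  obtain ⟨Y, hY⟩ := E.transition_drivenF H (E.meanA c) (E.meanGain H t) c.m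
  set Ψ := transition (E.drivenF H (E.meanA c) (E.meanGain H t)) c.m with hΨ
  have hfix : Ψ *ᵥ Sum.elim (0 : ObsIdx n → ℝ) ![1, 0] = Sum.elim (0 : ObsIdx n → ℝ) ![1, 0] := by
    rw [hY, hΦ, Matrix.fromBlocks_mulVec]
    ext (a | a)
    · simp
    · fin_cases a <;> simp
  -- The phase direction of ξ̂_ō is a right fixed vector, so a left one exists too. It may have an
  -- observable component γ, which the variance argument then eliminates.
  have hdet : (Ψ - 1).det = 0 := by
    refine Matrix.exists_mulVec_eq_zero_iff.1 ⟨Sum.elim (0 : ObsIdx n → ℝ) ![1, 0],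
      fun h0 => ?_, ?_⟩
    · simpa using congrFun h0 (Sum.inr 0)
    · rw [Matrix.sub_mulVec, hfix, Matrix.one_mulVec, sub_self]
  obtain ⟨x, hx0, hx⟩ := Matrix.exists_vecMul_eq_zero_iff.2 hdet
  obtain ⟨γ, l, rfl⟩ : ∃ γ l, x = Sum.elim γ l := ⟨_, _, (Sum.elim_comp_inl_inr x).symm⟩
  rw [Matrix.vecMul_sub, Matrix.vecMul_one, sub_eq_zero] at hx
  obtain ⟨rfl, hl⟩ := E.vecMul_eq_zero_of_accumulatedCov c hq hqW hW hm le_rfl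
    (E.quad_accumulatedCov_eq_zero_of_achievesSync c hq hqW hW ht hm herr hν h hx)
  rw [hY, hΦ, Matrix.vecMul_fromBlocks] at hx
  have hl1 := congrFun hx (Sum.inr 1)
  simp only [Sum.elim_comp_inl, Sum.elim_comp_inr, Sum.elim_inr, Matrix.zero_vecMul, zero_add,
    Matrix.vecMul, dotProduct, Fin.sum_univ_two, Matrix.of_apply, Matrix.cons_val] at hl1
  rw [← Matrix.vecMul_vecMul, clockA_pow] at hl
  have hmτ : 0 < c.m * E.τ := mul_pos (by exact_mod_cast hm) E.τ_pos
  have ha0 : (l ᵥ* !![1, c.m * E.τ; 0, 1]) 0 = l 0 := by simp [Matrix.vecMul, dotProduct]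
  have ha1 : (l ᵥ* !![1, c.m * E.τ; 0, 1]) 1 = l 0 * (c.m * E.τ) + l 1 := by
    simp [Matrix.vecMul, dotProduct]
  -- For a = lA^m, the frequency column of the fixed-vector equation reads mτ a₀ = K₁ a₁. With K₁ ≥
  -- 0 this gives a₀a₁ ≥ 0, and a₁ = 0 would force l = 0.
  have hrel : c.m * E.τ * l 0 = c.K 1 * (l 0 * (c.m * E.τ) + l 1) := by
    linear_combination hl1
  refine hgain _ ?_ ?_ hl
  · rw [ha0, ha1]
    have h1 : c.m * E.τ * (l 0 * (l 0 * (c.m * E.τ) + l 1)) =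
        c.K 1 * (l 0 * (c.m * E.τ) + l 1) ^ 2 := by
      linear_combination (l 0 * (c.m * E.τ) + l 1) * hrel
    exact nonneg_of_mul_nonneg_right (by rw [h1]; exact mul_nonneg hK1 (sq_nonneg _)) hmτ
  · rw [ha1]
    intro h1
    rw [h1, mul_zero] at hrel
    have h2 : l 0 = 0 := (mul_eq_zero.1 hrel).resolve_left hmτ.ne'
    have h3 : l 1 = 0 := by simpa [h2] using h1
    refine hx0 ?_
    ext (a | a)
    · rfl
    · fin_cases a
      · exact h2
      · exact h3

end Ensemble

end ClockSync

/-! ### The equivalence -/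

theorem theorem4 {n : ℕ} (E : ClockSync.Ensemble n)
    (q : Fin (n + 1) → ℝ) (hq : ∑ i, q i = 1) (hq_ne : q ≠ E.qInf)
    (W : Matrix (Fin (n + 1)) (Fin n) ℝ) (hqW : q ᵥ* W = 0) (hW : W.rank = n)
    (P₀ : Matrix (ClockSync.ObsIdx n) (ClockSync.ObsIdx n) ℝ ×
      Matrix (Fin 2) (ClockSync.ObsIdx n) ℝ)
    (hP₀ : P₀.1.PosSemidef)
    (c : ClockSync.Controller n) (hm : 1 ≤ c.m)
    {Ω : Type*} [MeasurableSpace Ω] (P : Measure Ω) [IsProbabilityMeasure P]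
    (v : ℕ → Ω → ClockSync.Idx n → ℝ) (w : ℕ → Ω → Fin n → ℝ)
    (hv : ClockSync.IsWhiteGaussian v E.Q P) (hw : ClockSync.IsWhiteGaussian w E.R P)
    (hvw : IndepFun (fun ω k => v k ω) (fun ω k => w k ω) P) :
    E.AchievesSync P W (E.stationaryGain q W P₀) c E.qInf v w ↔
      ClockSync.IsSchur (E.Ao - E.Bo * c.Fo) ∧
      ClockSync.IsSchur (ClockSync.clockA E.τ ^ c.m -
        Matrix.vecMulVec (ClockSync.clockA E.τ ^ (c.m - 1) *ᵥ ClockSync.clockB E.τ) c.K) := by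
  obtain ⟨Ps, hPs, hfix, hgain⟩ := E.exists_stationaryGain_eq hq hqW hW hP₀
  have ht := E.offsetRow_vecMul hq hqW hW
  have hν := hv.sumElim hw hvw
  have herr : Tendsto (fun k => E.errA (ClockSync.kalmanGain E.Co E.R Ps) ^ k) atTop (𝓝 0) :=
    ClockSync.tendsto_pow_of_riccati_eq E.R_posDef (E.obsCov_posDef hq hqW hW) hPs hfix
  rw [hgain, ← E.transition_meanA c hm]
  constructor
  · exact fun h => ⟨E.isSchur_of_achievesSync c hq hqW hW ht hm hν h,
      E.isSchur_mean_of_achievesSync c hq hqW hW ht hm herr hν h fun a ha ha1 =>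
        E.vecMul_gain_ne_zero hq hqW hW hPs hfix hq_ne ha ha1⟩
  · exact fun h => E.achievesSync_of_isSchur c hq hqW hW ht hm herr hν h.1 h.2
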